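/- Let $p,L\ge 0$ be integers and let $\Lambda$ be the complex Grassmann algebra generated by $\eta_1,\eta_1^*,\dots,\eta_L,\eta_L^*$, with even part $\Lambda^0$. Let $M\subset\mathbb R^p$ be open. A smooth superfunction over $M$ is $f(x,\eta)=\sum_{j_1,j_2\in\{0,1\}^L}f_{j_1j_2}(x)\prod_{n=1}^L(\eta_n^*)^{j_{1n}}\eta_n^{j_{2n}}$ with smooth coefficients $f_{j_1j_2}:M\to\mathbb C$; its body is $f(x,0)=f_{00}(x)$. If $F$ is a smooth complex function of $k$ real variables and $a=(a_1,\dots,a_k)$ are elements of $\Lambda^0$ whose bodies $a_i^{(0)}$ are real and form a point of the open domain of $F$, then $F(a)\in\Lambda$ denotes the (terminating) Taylor series of $F$ at $a^{(0)}$ in the nilpotent elements $a_i-a_i^{(0)}$. Grassmann derivatives are left derivatives. The Berezin integral over one Grassmann variable is normalized by $\int\eta^n\,d\eta=\delta_{n1}/\sqrt{2\pi}$, $n\in\{0,1\}$, and $d[\eta]=\prod_n d\eta_n\,d\eta_n^*$ is ordered so that $\int\eta^*\eta\, d[\eta]=1/(2\pi)$ for one pair. Let $g_1,\dots,g_p>0$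 and $h_1,\dots,h_L\in\mathbb C\setminus\{0\}$; they give the constant diagonal metric $\sum_n g_na_nb_n+\sum_m h_m(\alpha_m^*\beta_m+\beta_m^*\alpha_m)$. Put $$\Delta_C=\sum_{n=1}^p\frac1{g_n}\frac{\partial^2}{\partial x_n^2},\qquad \Delta_S=\Delta_C+2\sum_{m=1}^L\frac1{h_m}\frac{\partial^2}{\partial\eta_m^*\partial\eta_m},$$ and, for even superfunctions $u,v$, $\langle\nabla u,\nabla v\rangle=\tfrac12\big(\Delta_S(uv)-u\,\Delta_Sv-v\,\Delta_Su\big)$. Let $r=(r_1,\dots,r_p)$ be even smooth superfunctions over $M$ whose bodies are real and map $M$ into $M$. Let $W\subset M$ and $V\subset\mathbb R^k$ be open, and let $\rho=(\rho_1,\dots,\rho_k)$ (the radial variables) be even smooth superfunctions over $W$ whose bodies are real and map $W$ into $V$, such that $r(x,\eta)=\iota(\rho(x,\eta))$ over $W$ for a smooth map $\iota:V\to M$. Assume that $\Delta_S$ has a radial part in these variables, that is, there are smooth functions $A_{ij},B_i:V\to\mathbb C$ with $$\langle\nabla\rho_i,\nabla\rho_j\rangle=A_{ij}(\rho),\qquad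 \Delta_S\rho_i=B_i(\rho)\qquad\text{over }W,$$ and let $\Delta_{S,r}=\sum_{i,j}A_{ij}\,\partial_i\partial_j+\sum_iB_i\,\partial_i$ be this radial part, a differential operator on functions on $V$. Let $f$ be any smooth superfunction over $M$ with $f(x,\eta)=f(r(x,\eta),0)$, and let $F(v)=f(\iota(v),0)$ be $f(r,0)$ written in the radial variables. Then for every $x\in W$ $$\int f(x,\eta)\,d[\eta]=(D_{C,S}F)(x),$$ where $$(D_{C,S}F)(x)=\frac{\prod_{m=1}^Lh_m}{L!\,(4\pi)^L}\sum_{n=0}^L\binom Ln\,\Delta_C^{L-n}\Big[\big((-\Delta_{S,r})^nF\big)(\rho(x,0))\Big],$$ with $\Delta_{S,r}$ acting in the radial variables and $\Delta_C$ acting on the resulting function of $x$. -/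

import Mathlib

open scoped ContDiff

noncomputable section

namespace FlatSuper

/-! ## The Grassmann algebra -/

/-- Labels of the `2 L` Grassmann generators: `(m, true)` labels `η_m`, `(m, false)` labels `η_m^*`.
The lexicographic order is `η_1^*, η_1, η_2^*, η_2, …`. -/
abbrev Gen (L : ℕ) : Type := Fin L ×ₗ Bool

/-- The complex Grassmann algebra in the `2 L` generators `η_m, η_m^*`. -/
abbrev Grassmann (L : ℕ) : Type := ExteriorAlgebra ℂ (Gen L → ℂ)

/-- The label of `η_m`. -/
def etaIdx {L : ℕ} (m : Fin L) : Gen L := toLex (m, true)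

/-- The label of `η_m^*`. -/
def etaStarIdx {L : ℕ} (m : Fin L) : Gen L := toLex (m, false)

/-- The generator with label `s`. -/
def gen {L : ℕ} (s : Gen L) : Grassmann L := ExteriorAlgebra.ι ℂ (Pi.single s (1 : ℂ))

/-- The basis of the Grassmann algebra made of the ordered monomials
`∏_n (η_n^*)^{j_{1n}} η_n^{j_{2n}}`; a set of generators stands for a pair `(j₁, j₂)`. -/
def monomialBasis (L : ℕ) : Module.Basis (Finset (Gen L)) ℂ (Grassmann L) :=
  (Pi.basisFun ℂ (Gen L)).ExteriorAlgebra

/-- The coefficient of a monomial. -/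
def coeff {L : ℕ} (S : Finset (Gen L)) (u : Grassmann L) : ℂ := (monomialBasis L).repr u S

/-- The body (the part of degree zero) of an element of the Grassmann algebra. -/
def body {L : ℕ} (u : Grassmann L) : ℂ := ExteriorAlgebra.algebraMapInv u

/-- The soul (the nilpotent part) of an element of the Grassmann algebra. -/
def soul {L : ℕ} (u : Grassmann L) : Grassmann L :=
  u - algebraMap ℂ (Grassmann L) (body u)

/-- The even part `Λ⁰` of the Grassmann algebra. -/
def evenPart (L : ℕ) : Subalgebra ℂ (Grassmann L) :=
  CliffordAlgebra.even (0 : QuadraticForm ℂ (Gen L → ℂ))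

/-- The (left) derivative with respect to the generator with label `s`. It is the antiderivation
with `∂_s (η_s u) = u - η_s ∂_s u` and `∂_s (η_t u) = - η_t ∂_s u` for `t ≠ s`. -/
def gderiv {L : ℕ} (s : Gen L) : Module.End ℂ (Grassmann L) :=
  CliffordAlgebra.contractLeft (LinearMap.proj s : (Gen L → ℂ) →ₗ[ℂ] ℂ)

/-- Berezin integration over the single generator with label `s`, normalised by
`∫ η^n dη = δ_{n1} / √(2π)`. -/
def berezinOne {L : ℕ} (s : Gen L) : Module.End ℂ (Grassmann L) :=
  (((1 / Real.sqrt (2 * Real.pi) : ℝ) : ℂ)) • gderiv s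

/-- The Berezin integral over all Grassmann variables, `d[η] = ∏_n dη_n dη_n^*`, so that
`∫ η^* η d[η] = 1 / (2π)` for one pair. -/
def berezin {L : ℕ} (u : Grassmann L) : ℂ :=
  body ((List.ofFn fun m : Fin L => berezinOne (etaIdx m) * berezinOne (etaStarIdx m)).prod u)

/-! ## Differential operators -/

/-- The partial derivative `∂/∂x_i` of a complex function of `n` real variables. -/
def pd {n : ℕ} (i : Fin n) (F : (Fin n → ℝ) → ℂ) : (Fin n → ℝ) → ℂ :=
  fun x => fderiv ℝ F x (Pi.single i 1)

/-- A superfunction with `p` real variables is given by `x ↦ f(x, η)`, which is the same as its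
family of coefficient functions `f_{j₁ j₂}`. It is smooth if all its coefficients are. -/
def SuperSmoothOn {p L : ℕ} (f : (Fin p → ℝ) → Grassmann L) (U : Set (Fin p → ℝ)) : Prop :=
  ∀ S : Finset (Gen L), ContDiffOn ℝ ∞ (fun x => coeff S (f x)) U

/-- The partial derivative `∂/∂x_i` of a superfunction: it acts on the coefficients. -/
def spd {p L : ℕ} (i : Fin p) (f : (Fin p → ℝ) → Grassmann L) : (Fin p → ℝ) → Grassmann L :=
  fun x => ∑ S : Finset (Gen L), pd i (fun y => coeff S (f y)) x • monomialBasis L S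

/-- The Laplacian `Δ_C = ∑_n g_n⁻¹ ∂²/∂x_n²` on complex functions of the real variables. -/
def lapC {p : ℕ} (g : Fin p → ℝ) (F : (Fin p → ℝ) → ℂ) : (Fin p → ℝ) → ℂ :=
  fun x => ∑ n, (1 / g n : ℂ) * pd n (pd n F) x

/-- The super-Laplacian
`Δ_S = ∑_n g_n⁻¹ ∂²/∂x_n² + 2 ∑_m h_m⁻¹ ∂²/(∂η_m^* ∂η_m)`, the Laplace-Beltrami operator of the
metric `∑_n g_n a_n b_n + ∑_m h_m (α_m^* β_m + β_m^* α_m)`. -/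
def lapS {p L : ℕ} (g : Fin p → ℝ) (h : Fin L → ℂ) (f : (Fin p → ℝ) → Grassmann L) :
    (Fin p → ℝ) → Grassmann L :=
  fun x => ∑ n, (1 / g n : ℂ) • spd n (spd n f) x
    + (2 : ℂ) • ∑ m, (1 / h m) • gderiv (etaStarIdx m) (gderiv (etaIdx m) (f x))

/-- The inner product of the gradients of two even superfunctions `u`, `v`. It is one half of
`Δ_S (u v) - u Δ_S v - v Δ_S u`. -/
def gradInner {p L : ℕ} (g : Fin p → ℝ) (h : Fin L → ℂ)
    (u v : (Fin p → ℝ) → Grassmann L) : (Fin p → ℝ) → Grassmann L :=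
  fun x => ∑ n, (1 / g n : ℂ) • (spd n u x * spd n v x)
    + ∑ m, (1 / h m) •
      (gderiv (etaStarIdx m) (u x) * gderiv (etaIdx m) (v x)
        - gderiv (etaIdx m) (u x) * gderiv (etaStarIdx m) (v x))

/-! ## Functions of even Grassmann elements -/

/-- The (real) body of a tuple of even elements. -/
def realBody {k L : ℕ} (a : Fin k → Grassmann L) : Fin k → ℝ := fun i => (body (a i)).re

/-- `taylorTerm a m F = ∑_{i_1, …, i_m} (∂_{i_1} ⋯ ∂_{i_m} F)(body a) • soul a_{i_1} ⋯ soul a_{i_m}`. -/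
def taylorTerm {k L : ℕ} (a : Fin k → Grassmann L) : ℕ → ((Fin k → ℝ) → ℂ) → Grassmann L
  | 0, F => algebraMap ℂ (Grassmann L) (F (realBody a))
  | m + 1, F => ∑ i, taylorTerm a m (pd i F) * soul (a i)

/-- The value `F(a)` of a smooth function `F` of `k` real variables at a tuple `a` of even elements
with real body, by the Taylor expansion in the souls. Even souls have degree at least two, so that
products of more than `L` of them vanish and the expansion stops. -/
def evalEven {k L : ℕ} (F : (Fin k → ℝ) → ℂ) (a : Fin k → Grassmann L) : Grassmann L :=
  ∑ m ∈ Finset.range (L + 1), (1 / (m.factorial : ℂ)) • taylorTerm a m F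

/-- `ρ = (ρ_1, …, ρ_k)` is a tuple of smooth even superfunctions over `U` whose body is real and
takes values in `V`. -/
structure IsEvenMap {p k L : ℕ} (ρ : (Fin p → ℝ) → Fin k → Grassmann L)
    (U : Set (Fin p → ℝ)) (V : Set (Fin k → ℝ)) : Prop where
  smooth : ∀ i, SuperSmoothOn (fun x => ρ x i) U
  even : ∀ x ∈ U, ∀ i, ρ x i ∈ evenPart L
  real : ∀ x ∈ U, ∀ i, (body (ρ x i)).im = 0
  mapsTo : ∀ x ∈ U, realBody (ρ x) ∈ V

/-! ## Radial variables and the radial part of the Laplacian -/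

/-- Radial variables for the even map `r`, over the open set `W`: the image of `r` is parametrised
by `k` real variables through `emb : V → M`, and `r(x, η) = emb (ρ(x, η))`. The even superfunctions
`ρ_1, …, ρ_k` are the radial variables. -/
structure IsRadialVariables {p k L : ℕ} (r : (Fin p → ℝ) → Fin p → Grassmann L)
    (ρ : (Fin p → ℝ) → Fin k → Grassmann L) (emb : (Fin k → ℝ) → Fin p → ℝ)
    (M W : Set (Fin p → ℝ)) (V : Set (Fin k → ℝ)) : Prop where
  isOpen_W : IsOpen W
  subset : W ⊆ M
  isOpen_V : IsOpen V
  evenMap : IsEvenMap ρ W V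
  smooth_emb : ContDiffOn ℝ ∞ emb V
  mapsTo_emb : Set.MapsTo emb V M
  factor : ∀ x ∈ W, ∀ j, r x j = evalEven (fun v => ((emb v j : ℝ) : ℂ)) (ρ x)

/-- The second order differential operator `∑_{ij} A_{ij} ∂_i ∂_j + ∑_i B_i ∂_i` in the
radial variables. -/
def radialOp {k : ℕ} (A : Fin k → Fin k → (Fin k → ℝ) → ℂ) (B : Fin k → (Fin k → ℝ) → ℂ)
    (F : (Fin k → ℝ) → ℂ) : (Fin k → ℝ) → ℂ :=
  fun v => ∑ i, ∑ j, A i j v * pd i (pd j F) v + ∑ i, B i v * pd i F v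

/-- `radialOp A B` is the radial part `Δ_{S,r}` of `Δ_S` in the radial variables `ρ`.

In any coordinates that consist of `ρ_1, …, ρ_k` and of further (angular) coordinates, the terms of
`Δ_S` without angular derivatives are
`∑_{ij} ⟨∇ρ_i, ∇ρ_j⟩ ∂²/∂ρ_i ∂ρ_j + ∑_i (Δ_S ρ_i) ∂/∂ρ_i`. That `Δ_S` has a radial part means that
these coefficients depend only on the radial variables: they are `A_{ij}(ρ)` and `B_i(ρ)` for smooth
functions `A_{ij}`, `B_i` of `k` real variables. -/
structure IsRadialPart {p k L : ℕ} (g : Fin p → ℝ) (h : Fin L → ℂ)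
    (ρ : (Fin p → ℝ) → Fin k → Grassmann L) (W : Set (Fin p → ℝ)) (V : Set (Fin k → ℝ))
    (A : Fin k → Fin k → (Fin k → ℝ) → ℂ) (B : Fin k → (Fin k → ℝ) → ℂ) : Prop where
  smooth_A : ∀ i j, ContDiffOn ℝ ∞ (A i j) V
  smooth_B : ∀ i, ContDiffOn ℝ ∞ (B i) V
  second_order : ∀ i j, ∀ x ∈ W,
    gradInner g h (fun y => ρ y i) (fun y => ρ y j) x = evalEven (A i j) (ρ x)
  first_order : ∀ i, ∀ x ∈ W, lapS g h (fun y => ρ y i) x = evalEven (B i) (ρ x)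

/-- The differential operator
`D_{C,S} = (∏_m h_m) / (L! (4π)^L) ∑_n binom(L, n) Δ_C^{L-n} (-Δ_{S,r})^n`.
It is applied to a function `F` of the radial variables. After the operators `-Δ_{S,r}`, which act
in the radial variables, the radial variables are replaced by their bodies `ρ(x, 0)`, and `Δ_C` acts
on the resulting function of `x`. -/
def opDCS {p k L : ℕ} (g : Fin p → ℝ) (h : Fin L → ℂ) (ρ : (Fin p → ℝ) → Fin k → Grassmann L)
    (A : Fin k → Fin k → (Fin k → ℝ) → ℂ) (B : Fin k → (Fin k → ℝ) → ℂ)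
    (F : (Fin k → ℝ) → ℂ) : (Fin p → ℝ) → ℂ :=
  fun x => (∏ m, h m) / ((L.factorial : ℂ) * (4 * (Real.pi : ℂ)) ^ L) *
    ∑ n ∈ Finset.range (L + 1), (L.choose n : ℂ) *
      (lapC g)^[L - n] (fun y => (fun G => -radialOp A B G)^[n] F (realBody (ρ y))) x

end FlatSuper

end

/-!
The Grassmann part `N = 2 ∑_m h_m⁻¹ ∂²/(∂η_m^* ∂η_m)` of `Δ_S = Δ_C + N` is a sum of `L` commuting
operators with square zero. Its power `N ^ L` is therefore `L!` times their product, which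
differentiates once with respect to every generator, and up to a constant the Berezin integral is
the body of `(-N) ^ L` (`berezin_eq_body_lapEta_pow`). Since `-N = Δ_C - Δ_S` and the two Laplacians
commute, the binomial theorem (`pointwise_neg_lapEta_pow`) gives
`(-N) ^ L = ∑_n (L choose n) Δ_C ^ (L - n) (-Δ_S) ^ n`. Taking the body commutes with `Δ_C`, and on
functions `F(ρ)` of the radial variables `Δ_S` acts as its radial part
(`lapS_evalEven_eq_evalEven_radialOp`), so that the body of `(-Δ_S) ^ n f` is
`((-Δ_{S,r}) ^ n F)(ρ(x, 0))`.

What has to be shown about the Taylor evaluation `evalEven` is that it obeys the chain rule for the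
derivatives in `x` and in the generators (`spd_evalEven`, `gderiv_evalEven`), is multiplicative
(`evalEven_mul`) and respects composition (`evalEven_comp`). The last two follow from the chain
rule: the defect of either identity has body zero, and its Grassmann derivatives are combinations of
defects of the same kind, so that it lies in every step of the degree filtration `degreeGE`, which
ends after `2 L` steps (`eq_zero_of_mem_degreeGE`).
-/

open scoped ContDiff

noncomputable section

namespace FlatSuper

/-! ### Left derivatives, parity and the degree filtration of the Grassmann algebra -/

section Algebra

variable {L : ℕ}

theorem grassmann_induction {P : Grassmann L → Prop}
    (scalar : ∀ c : ℂ, P (algebraMap ℂ (Grassmann L) c))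
    (add : ∀ u v, P u → P v → P (u + v))
    (ι_mul : ∀ u w, P u → P (ExteriorAlgebra.ι ℂ w * u)) (u : Grassmann L) : P u :=
  CliffordAlgebra.left_induction (Q := (0 : QuadraticForm ℂ (Gen L → ℂ))) scalar add ι_mul u

/-- The grading automorphism `u ↦ (-1)^{deg u} u`. -/
def parity : Grassmann L →ₐ[ℂ] Grassmann L :=
  CliffordAlgebra.involute (Q := (0 : QuadraticForm ℂ (Gen L → ℂ)))

theorem parity_ι (w : Gen L → ℂ) :
    parity (ExteriorAlgebra.ι ℂ w) = -ExteriorAlgebra.ι ℂ w :=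
  CliffordAlgebra.involute_ι w

theorem body_algebraMap (c : ℂ) : body (algebraMap ℂ (Grassmann L) c) = c :=
  ExteriorAlgebra.algebraMap_leftInverse (Gen L → ℂ) c

theorem body_ι (w : Gen L → ℂ) : body (ExteriorAlgebra.ι ℂ w) = 0 := by
  simp [body, ExteriorAlgebra.algebraMapInv]

theorem body_add (u v : Grassmann L) : body (u + v) = body u + body v :=
  map_add ExteriorAlgebra.algebraMapInv u v

theorem body_sub (u v : Grassmann L) : body (u - v) = body u - body v :=
  map_sub ExteriorAlgebra.algebraMapInv u v

theorem body_mul (u v : Grassmann L) : body (u * v) = body u * body v :=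
  map_mul ExteriorAlgebra.algebraMapInv u v

theorem body_smul (c : ℂ) (u : Grassmann L) : body (c • u) = c * body u :=
  map_smul ExteriorAlgebra.algebraMapInv c u

theorem body_sum {ι : Type*} (t : Finset ι) (u : ι → Grassmann L) :
    body (∑ i ∈ t, u i) = ∑ i ∈ t, body (u i) :=
  map_sum ExteriorAlgebra.algebraMapInv u t

theorem body_soul (u : Grassmann L) : body (soul u) = 0 := by
  rw [soul, body_sub, body_algebraMap, sub_self]

theorem gderiv_algebraMap (s : Gen L) (c : ℂ) : gderiv s (algebraMap ℂ (Grassmann L) c) = 0 :=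
  CliffordAlgebra.contractLeft_algebraMap _ _ c

theorem gderiv_ι_mul (s : Gen L) (w : Gen L → ℂ) (u : Grassmann L) :
    gderiv s (ExteriorAlgebra.ι ℂ w * u) = w s • u - ExteriorAlgebra.ι ℂ w * gderiv s u :=
  CliffordAlgebra.contractLeft_ι_mul _ w u

theorem gderiv_gderiv_self (s : Gen L) (u : Grassmann L) : gderiv s (gderiv s u) = 0 :=
  CliffordAlgebra.contractLeft_contractLeft _ u

theorem gderiv_comm (s t : Gen L) (u : Grassmann L) :
    gderiv s (gderiv t u) = -gderiv t (gderiv s u) :=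
  CliffordAlgebra.contractLeft_comm _ _ u

theorem gderiv_soul (s : Gen L) (u : Grassmann L) : gderiv s (soul u) = gderiv s u := by
  rw [soul, map_sub, gderiv_algebraMap, sub_zero]

theorem gderiv_mul (s : Gen L) (u v : Grassmann L) :
    gderiv s (u * v) = gderiv s u * v + parity u * gderiv s v := by
  induction u using grassmann_induction with
  | scalar c =>
    rw [← Algebra.smul_def, map_smul, gderiv_algebraMap, AlgHom.commutes, Algebra.smul_def,
      zero_mul, zero_add]
  | add x y hx hy => simp only [add_mul, map_add, hx, hy]; abel
  | ι_mul x w hx =>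
    rw [mul_assoc, gderiv_ι_mul, hx, gderiv_ι_mul, map_mul, parity_ι]
    simp only [mul_add, sub_mul, smul_mul_assoc, neg_mul, mul_assoc]
    abel

theorem parity_gderiv (s : Gen L) (u : Grassmann L) :
    parity (gderiv s u) = -gderiv s (parity u) := by
  induction u using grassmann_induction with
  | scalar c => simp only [gderiv_algebraMap, map_zero, AlgHom.commutes, neg_zero]
  | add x y hx hy => simp only [map_add, hx, hy]; abel
  | ι_mul x w hx =>
    rw [gderiv_ι_mul, map_sub, map_smul, map_mul, map_mul, parity_ι, hx, neg_mul, neg_mul,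
      map_neg, gderiv_ι_mul]
    simp only [mul_neg]
    abel

theorem body_parity (u : Grassmann L) : body (parity u) = body u := by
  induction u using grassmann_induction with
  | scalar c => rw [AlgHom.commutes]
  | add x y hx hy => simp only [map_add, body_add, hx, hy]
  | ι_mul x w hx => 
    rw [map_mul, parity_ι, body_mul, body_mul, body_ι, ← neg_one_smul ℂ, body_smul, body_ι,
      mul_zero, zero_mul, zero_mul]

theorem even_induction {P : Grassmann L → Prop}
    (scalar : ∀ c : ℂ, P (algebraMap ℂ (Grassmann L) c))
    (add : ∀ u v, P u → P v → P (u + v))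
    (ι_mul : ∀ u v w, P u → P (ExteriorAlgebra.ι ℂ v * ExteriorAlgebra.ι ℂ w * u))
    {u : Grassmann L} (hu : u ∈ evenPart L) : P u :=
  CliffordAlgebra.even_induction (Q := (0 : QuadraticForm ℂ (Gen L → ℂ)))
    (motive := fun x _ => P x) scalar
    (fun x y _ _ => add x y) (fun v w x _ => ι_mul x v w) u hu

theorem parity_of_even {u : Grassmann L} (hu : u ∈ evenPart L) : parity u = u :=
  CliffordAlgebra.involute_eq_of_mem_even hu

theorem ι_mul_eq_parity_mul (w : Gen L → ℂ) (y : Grassmann L) :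
    ExteriorAlgebra.ι ℂ w * y = parity y * ExteriorAlgebra.ι ℂ w := by
  induction y using grassmann_induction with
  | scalar c => rw [AlgHom.commutes, Algebra.commutes]
  | add x y hx hy => rw [mul_add, hx, hy, map_add, add_mul]
  | ι_mul x v hx =>
    rw [map_mul, parity_ι, mul_assoc, ← hx, ← mul_assoc, ← mul_assoc,
      eq_neg_of_add_eq_zero_left (ExteriorAlgebra.ι_add_mul_swap w v), neg_mul, neg_mul,
      neg_mul]

theorem parity_parity (u : Grassmann L) : parity (parity u) = u :=
  CliffordAlgebra.involute_involute u

theorem even_mul_comm {u : Grassmann L} (hu : u ∈ evenPart L) (y : Grassmann L) :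
    u * y = y * u := by
  refine even_induction (P := fun u => u * y = y * u) (fun c => Algebra.commutes c y)
    (fun u v hu hv => by rw [add_mul, hu, hv, mul_add]) (fun u v w hu => ?_) hu
  rw [mul_assoc, hu, ← mul_assoc, mul_assoc (ExteriorAlgebra.ι ℂ v), ι_mul_eq_parity_mul w,
    ← mul_assoc, ι_mul_eq_parity_mul v (parity y), parity_parity, mul_assoc y, mul_assoc y]

/-- The derivative of an even element is odd, hence commutes with every element up to parity. This
comes from differentiating `u * y = y * u`. -/
theorem gderiv_even_mul {u : Grassmann L} (hu : u ∈ evenPart L) (s : Gen L) (y : Grassmann L) :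
    gderiv s u * y = parity y * gderiv s u := by
  have h1 := congrArg (gderiv s) (even_mul_comm hu y)
  rw [gderiv_mul, gderiv_mul, parity_of_even hu, even_mul_comm hu] at h1
  rw [add_comm] at h1
  exact add_left_cancel h1

theorem gderiv_even_anticomm {u v : Grassmann L} (hu : u ∈ evenPart L) (hv : v ∈ evenPart L)
    (s t : Gen L) : gderiv s u * gderiv t v = -(gderiv t v * gderiv s u) := by
  rw [gderiv_even_mul hu, parity_gderiv, parity_of_even hv, neg_mul]

theorem gderiv_mul_of_even (s : Gen L) {u : Grassmann L} (hu : u ∈ evenPart L)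
    (v : Grassmann L) : gderiv s (u * v) = gderiv s u * v + u * gderiv s v := by
  rw [gderiv_mul, parity_of_even hu]

theorem soul_mem_evenPart {u : Grassmann L} (hu : u ∈ evenPart L) : soul u ∈ evenPart L :=
  sub_mem hu ((evenPart L).algebraMap_mem _)

theorem body_gderiv_of_even {u : Grassmann L} (hu : u ∈ evenPart L) (s : Gen L) :
    body (gderiv s u) = 0 := by
  have h1 := congrArg body (parity_gderiv s u)
  rw [body_parity, parity_of_even hu, ← neg_one_smul ℂ, body_smul] at h1
  linear_combination h1 / 2

/-- Setting the generators in `T` to zero. -/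
def killCoords (T : Finset (Gen L)) : (Gen L → ℂ) →ₗ[ℂ] (Gen L → ℂ) where
  toFun w s := if s ∈ T then 0 else w s
  map_add' v w := by ext s; by_cases h : s ∈ T <;> simp [h]
  map_smul' c w := by ext s; by_cases h : s ∈ T <;> simp [h]

/-- The operator `u ↦ u - η_s ∂_s u` is the algebra endomorphism that sets `η_s` to zero. -/
theorem map_killCoords_singleton (s : Gen L) (u : Grassmann L) :
    ExteriorAlgebra.map (killCoords {s}) u = u - gen s * gderiv s u := by
  induction u using grassmann_induction with
  | scalar c => rw [AlgHom.commutes, gderiv_algebraMap, mul_zero, sub_zero]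
  | add x y hx hy => simp only [map_add, hx, hy, mul_add]; abel
  | ι_mul x w hx =>
    have hk : killCoords {s} w = w - w s • Pi.single s 1 := by
      ext t
      by_cases h : t = s
      · subst h; simp [killCoords]
      · simp [killCoords, h]
    have h1 : ExteriorAlgebra.ι ℂ w * gen s = -(gen s * ExteriorAlgebra.ι ℂ w) :=
      eq_neg_of_add_eq_zero_left (ExteriorAlgebra.ι_add_mul_swap w _)
    have h2 : gen s * gen s = 0 := ExteriorAlgebra.ι_sq_zero _
    have h3 : ExteriorAlgebra.ι ℂ (killCoords {s} w) = ExteriorAlgebra.ι ℂ w - w s • gen s := by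
      rw [hk, map_sub, map_smul, gen]
    rw [map_mul, hx, ExteriorAlgebra.map_apply_ι, h3, gderiv_ι_mul]
    simp only [sub_mul, mul_sub, ← mul_assoc, h1, h2, smul_mul_assoc, mul_smul_comm, zero_mul,
      smul_zero, neg_mul]
    abel

/-- An element whose first derivatives all vanish is a scalar. -/
theorem eq_algebraMap_body_of_gderiv_eq_zero {u : Grassmann L} (hu : ∀ s, gderiv s u = 0) :
    u = algebraMap ℂ (Grassmann L) (body u) := by
  have key : ∀ T : Finset (Gen L), ExteriorAlgebra.map (killCoords T) u = u := by
    intro T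
    induction T using Finset.induction_on with
    | empty =>
      have : killCoords (∅ : Finset (Gen L)) = LinearMap.id := by ext; simp [killCoords]
      rw [this, ExteriorAlgebra.map_id, AlgHom.id_apply]
    | insert s T _ ih =>
      have : killCoords (insert s T) = killCoords {s} ∘ₗ killCoords T := by
        ext w t
        by_cases h : t = s <;> by_cases h' : t ∈ T <;> simp [killCoords, h, h']
      rw [this, ← ExteriorAlgebra.map_comp_map, AlgHom.comp_apply, ih, map_killCoords_singleton,
        hu, mul_zero, sub_zero]
  have h0 : ∀ x : Grassmann L, ExteriorAlgebra.map (killCoords (Finset.univ : Finset (Gen L))) x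
      = algebraMap ℂ (Grassmann L) (body x) := by
    intro x
    induction x using grassmann_induction with
    | scalar c => rw [AlgHom.commutes, body_algebraMap]
    | add x y hx hy => rw [map_add, hx, hy, body_add, map_add]
    | ι_mul x w hx =>
      have : killCoords (Finset.univ : Finset (Gen L)) w = 0 := by ext; simp [killCoords]
      rw [map_mul, ExteriorAlgebra.map_apply_ι, this, map_zero, zero_mul, body_mul, body_ι,
        zero_mul, map_zero]
  rw [← h0, key]

/-- The set of elements of degree at least `m`, described by the vanishing of the bodies of all
derivatives of order less than `m`. -/
def degreeGE (L : ℕ) : ℕ → Set (Grassmann L)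
  | 0 => Set.univ
  | m + 1 => {u | body u = 0 ∧ ∀ s, gderiv s u ∈ degreeGE L m}

theorem degreeGE_mono_succ (m : ℕ) {u : Grassmann L} (hu : u ∈ degreeGE L (m + 1)) :
    u ∈ degreeGE L m := by
  induction m generalizing u with
  | zero => trivial
  | succ m ih => exact ⟨hu.1, fun s => ih (hu.2 s)⟩

theorem degreeGE_anti {m n : ℕ} (hmn : m ≤ n) {u : Grassmann L} (hu : u ∈ degreeGE L n) :
    u ∈ degreeGE L m := by
  induction hmn with
  | refl => exact hu
  | step _ ih => exact ih (degreeGE_mono_succ _ hu)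

theorem zero_mem_degreeGE (m : ℕ) : (0 : Grassmann L) ∈ degreeGE L m := by
  induction m with
  | zero => trivial
  | succ m ih => exact ⟨map_zero ExteriorAlgebra.algebraMapInv, fun s => by rwa [map_zero]⟩

theorem add_mem_degreeGE {m : ℕ} {u v : Grassmann L} (hu : u ∈ degreeGE L m)
    (hv : v ∈ degreeGE L m) : u + v ∈ degreeGE L m := by
  induction m generalizing u v with
  | zero => trivial
  | succ m ih =>
    exact ⟨by rw [body_add, hu.1, hv.1, add_zero],
      fun s => by rw [map_add]; exact ih (hu.2 s) (hv.2 s)⟩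

theorem smul_mem_degreeGE {m : ℕ} (c : ℂ) {u : Grassmann L} (hu : u ∈ degreeGE L m) :
    c • u ∈ degreeGE L m := by
  induction m generalizing u with
  | zero => trivial
  | succ m ih =>
    exact ⟨by rw [body_smul, hu.1, mul_zero], fun s => by rw [map_smul]; exact ih (hu.2 s)⟩

theorem sum_mem_degreeGE {ι : Type*} {m : ℕ} (t : Finset ι) {u : ι → Grassmann L}
    (hu : ∀ i ∈ t, u i ∈ degreeGE L m) : ∑ i ∈ t, u i ∈ degreeGE L m :=
  Finset.sum_induction u (· ∈ degreeGE L m) (fun _ _ => add_mem_degreeGE) (zero_mem_degreeGE m) hu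

theorem parity_mem_degreeGE {m : ℕ} {u : Grassmann L} (hu : u ∈ degreeGE L m) :
    parity u ∈ degreeGE L m := by
  induction m generalizing u with
  | zero => trivial
  | succ m ih =>
    refine ⟨by rw [body_parity, hu.1], fun s => ?_⟩
    rw [← neg_neg (gderiv s (parity u)), ← parity_gderiv, ← neg_one_smul ℂ]
    exact smul_mem_degreeGE _ (ih (hu.2 s))

theorem mul_mem_degreeGE {m n : ℕ} {u v : Grassmann L} (hu : u ∈ degreeGE L m)
    (hv : v ∈ degreeGE L n) : u * v ∈ degreeGE L (m + n) := by
  induction hN : m + n generalizing m n u v with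
  | zero => trivial
  | succ N ih =>
    constructor
    · rw [body_mul]
      rcases Nat.eq_zero_or_pos m with rfl | hm
      · rw [(degreeGE_anti (m := 1) (by omega) hv).1, mul_zero]
      · rw [(degreeGE_anti (m := 1) (by omega) hu).1, zero_mul]
    · intro s
      rw [gderiv_mul]
      refine add_mem_degreeGE ?_ ?_
      · rcases m with _ | m
        · exact degreeGE_anti (by omega) (ih (m := 0) (n := N) (u := gderiv s u) trivial
            (degreeGE_anti (by omega) hv) (by omega))
        · exact ih (hu.2 s) hv (by omega)
      · rcases n with _ | n
        · exact degreeGE_anti (by omega) (ih (m := N) (n := 0) (v := gderiv s v)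
            (parity_mem_degreeGE (degreeGE_anti (by omega) hu)) trivial (by omega))
        · exact ih (parity_mem_degreeGE hu) (hv.2 s) (by omega)

/-- There are no elements of degree more than `2 L`: each derivative uses up one generator. -/
theorem eq_zero_of_mem_degreeGE {m : ℕ} (hm : 2 * L < m) {u : Grassmann L}
    (hu : u ∈ degreeGE L m) : u = 0 := by
  have key : ∀ (N : ℕ) (T : Finset (Gen L)), T.card = N → ∀ v ∈ degreeGE L (N + 1),
      (∀ s ∉ T, gderiv s v = 0) → v = 0 := by
    intro N
    induction N with
    | zero =>
      intro T hT v hv h0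
      rw [Finset.card_eq_zero] at hT
      subst hT
      rw [eq_algebraMap_body_of_gderiv_eq_zero fun s => h0 s (by simp), hv.1, map_zero]
    | succ N ih =>
      intro T hT v hv h0
      have h1 : ∀ s, gderiv s v = 0 := by
        intro s
        by_cases hs : s ∈ T
        · refine ih (T.erase s) (by rw [Finset.card_erase_of_mem hs, hT]; rfl) _ (hv.2 s) ?_
          intro t ht
          by_cases hts : t = s
          · rw [hts, gderiv_gderiv_self]
          · rw [gderiv_comm, h0 t (fun h => ht (Finset.mem_erase.2 ⟨hts, h⟩)), map_zero, neg_zero]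
        · exact h0 s hs
      rw [eq_algebraMap_body_of_gderiv_eq_zero h1, hv.1, map_zero]
  refine key (2 * L) Finset.univ ?_ u (degreeGE_anti hm hu)
    (fun s hs => absurd (Finset.mem_univ s) hs)
  rw [Finset.card_univ, Fintype.card_congr (toLex (α := Fin L × Bool)).symm, Fintype.card_prod,
    Fintype.card_fin, Fintype.card_bool, mul_comm]

theorem soul_mem_degreeGE {u : Grassmann L} (hu : u ∈ evenPart L) : soul u ∈ degreeGE L 2 :=
  ⟨body_soul u, fun s => ⟨body_gderiv_of_even (soul_mem_evenPart hu) s, fun _ => trivial⟩⟩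

end Algebra

/-! ### Partial derivatives of smooth functions of real variables -/

section PartialDerivatives

variable {k : ℕ} {V : Set (Fin k → ℝ)} {F G : (Fin k → ℝ) → ℂ}

theorem differentiableAt_of_smooth (hV : IsOpen V) (hF : ContDiffOn ℝ ∞ F V) {b : Fin k → ℝ}
    (hb : b ∈ V) : DifferentiableAt ℝ F b :=
  (hF.contDiffAt (hV.mem_nhds hb)).differentiableAt (by simp)

theorem pd_smooth (hV : IsOpen V) (hF : ContDiffOn ℝ ∞ F V) (i : Fin k) :
    ContDiffOn ℝ ∞ (pd i F) V :=
  (hF.fderiv_of_isOpen (m := ∞) hV (by simp)).clm_apply contDiffOn_const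

theorem pd_congr (hV : IsOpen V) (h : Set.EqOn F G V) (i : Fin k) :
    Set.EqOn (pd i F) (pd i G) V := fun b hb => by
  unfold pd
  rw [(h.eventuallyEq_of_mem (hV.mem_nhds hb)).fderiv_eq]

theorem pd_add (hV : IsOpen V) (hF : ContDiffOn ℝ ∞ F V) (hG : ContDiffOn ℝ ∞ G V) (i : Fin k) :
    Set.EqOn (pd i (fun v => F v + G v)) (fun v => pd i F v + pd i G v) V := fun b hb => by
  unfold pd
  rw [fderiv_fun_add (differentiableAt_of_smooth hV hF hb) (differentiableAt_of_smooth hV hG hb)]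
  rfl

theorem pd_neg (F : (Fin k → ℝ) → ℂ) (i : Fin k) :
    pd i (fun v => -F v) = fun v => -pd i F v := by
  ext v
  simp [pd, fderiv_fun_neg]

theorem pd_const (c : ℂ) (i : Fin k) : pd i (fun _ => c) = fun _ => 0 := by
  ext v
  simp [pd]

theorem pd_mul (hV : IsOpen V) (hF : ContDiffOn ℝ ∞ F V) (hG : ContDiffOn ℝ ∞ G V) (i : Fin k) :
    Set.EqOn (pd i (fun v => F v * G v)) (fun v => pd i F v * G v + F v * pd i G v) V :=
  fun b hb => by
  unfold pd
  rw [fderiv_fun_mul (differentiableAt_of_smooth hV hF hb) (differentiableAt_of_smooth hV hG hb)]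
  simp only [add_apply, smul_apply, smul_eq_mul]
  ring

theorem pd_sum {ι : Type*} (t : Finset ι) {F : ι → (Fin k → ℝ) → ℂ} (hV : IsOpen V)
    (hF : ∀ j ∈ t, ContDiffOn ℝ ∞ (F j) V) (i : Fin k) :
    Set.EqOn (pd i (fun v => ∑ j ∈ t, F j v)) (fun v => ∑ j ∈ t, pd i (F j) v) V :=
  fun b hb => by
  unfold pd
  rw [fderiv_fun_sum fun j hj => differentiableAt_of_smooth hV (hF j hj) hb]
  simp

theorem pd_mul_const (hV : IsOpen V) (hF : ContDiffOn ℝ ∞ F V) (c : ℂ) (i : Fin k) :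
    Set.EqOn (pd i (fun v => F v * c)) (fun v => pd i F v * c) V := fun b hb => by
  simp [pd_mul hV hF contDiffOn_const i hb, pd_const]

theorem pd_comm (hV : IsOpen V) (hF : ContDiffOn ℝ ∞ F V) (i j : Fin k) :
    Set.EqOn (pd i (pd j F)) (pd j (pd i F)) V := fun b hb => by
  have hd : DifferentiableAt ℝ (fderiv ℝ F) b :=
    ((hF.fderiv_of_isOpen (m := ∞) hV (by simp)).contDiffAt (hV.mem_nhds hb)).differentiableAt
      (by simp)
  have h1 : ∀ i j, pd i (pd j F) b = fderiv ℝ (fderiv ℝ F) b (Pi.single i 1) (Pi.single j 1) := by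
    intro i j
    unfold pd
    rw [fderiv_clm_apply hd (differentiableAt_const _)]
    simp
  have h2 : IsSymmSndFDerivAt ℝ F b :=
    (hF.contDiffAt (hV.mem_nhds hb)).isSymmSndFDerivAt
      (by simpa using WithTop.coe_le_coe.2 (le_top : (2 : ℕ∞) ≤ ⊤))
  rw [h1, h1, h2.eq]

theorem pd_comp {p : ℕ} {M : Set (Fin p → ℝ)} {φ : (Fin p → ℝ) → ℂ}
    {e : (Fin k → ℝ) → Fin p → ℝ} (hV : IsOpen V) (hM : IsOpen M) (hφ : ContDiffOn ℝ ∞ φ M)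
    (he : ContDiffOn ℝ ∞ e V) (hmaps : Set.MapsTo e V M) (i : Fin k) :
    Set.EqOn (pd i (fun v => φ (e v)))
      (fun v => ∑ j, pd j φ (e v) * pd i (fun w => ((e w j : ℝ) : ℂ)) v) V := fun b hb => by
  have hde : DifferentiableAt ℝ e b := (he.contDiffAt (hV.mem_nhds hb)).differentiableAt (by simp)
  have hdφ : DifferentiableAt ℝ φ (e b) := differentiableAt_of_smooth hM hφ (hmaps hb)
  have h1 : ∀ j, pd i (fun w => ((e w j : ℝ) : ℂ)) b
      = ((fderiv ℝ e b (Pi.single i 1) j : ℝ) : ℂ) := by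
    intro j
    have : HasFDerivAt (fun w => ((e w j : ℝ) : ℂ))
        (Complex.ofRealCLM ∘L (ContinuousLinearMap.proj j ∘L fderiv ℝ e b)) b :=
      Complex.ofRealCLM.hasFDerivAt.comp b (hasFDerivAt_pi'.1 hde.hasFDerivAt j)
    unfold pd
    rw [this.fderiv]
    rfl
  have h2 : pd i (fun v => φ (e v)) b = fderiv ℝ φ (e b) (fderiv ℝ e b (Pi.single i 1)) := by
    unfold pd
    rw [show (fun v => φ (e v)) = φ ∘ e from rfl, fderiv_comp b hdφ hde]
    rfl
  simp only [h2, h1]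
  conv_lhs => rw [← Finset.univ_sum_single (fderiv ℝ e b (Pi.single i 1)), map_sum]
  refine Finset.sum_congr rfl fun j _ => ?_
  have : (Pi.single j (fderiv ℝ e b (Pi.single i 1) j) : Fin p → ℝ)
      = (fderiv ℝ e b (Pi.single i 1) j) • Pi.single j (1 : ℝ) := by
    rw [← Pi.single_smul, smul_eq_mul, mul_one]
  rw [this, map_smul, Complex.real_smul, mul_comm]
  rfl

end PartialDerivatives

/-! ### Smooth functions of even Grassmann elements -/

section Evaluation

variable {k L : ℕ} {V : Set (Fin k → ℝ)} {a : Fin k → Grassmann L} {F G : (Fin k → ℝ) → ℂ}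

theorem taylorTerm_congr (hV : IsOpen V) (ha : realBody a ∈ V) (m : ℕ) (h : Set.EqOn F G V) :
    taylorTerm a m F = taylorTerm a m G := by
  induction m generalizing F G with
  | zero => simp only [taylorTerm, h ha]
  | succ m ih =>
    simp only [taylorTerm]
    exact Finset.sum_congr rfl fun i _ => by rw [ih (pd_congr hV h i)]

theorem taylorTerm_add (hV : IsOpen V) (ha : realBody a ∈ V) (m : ℕ) (hF : ContDiffOn ℝ ∞ F V)
    (hG : ContDiffOn ℝ ∞ G V) :
    taylorTerm a m (fun v => F v + G v) = taylorTerm a m F + taylorTerm a m G := by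
  induction m generalizing F G with
  | zero => simp only [taylorTerm, map_add]
  | succ m ih =>
    simp only [taylorTerm]
    rw [← Finset.sum_add_distrib]
    refine Finset.sum_congr rfl fun i _ => ?_
    rw [taylorTerm_congr hV ha m (pd_add hV hF hG i), ih (pd_smooth hV hF i) (pd_smooth hV hG i),
      add_mul]

theorem taylorTerm_neg (m : ℕ) (F : (Fin k → ℝ) → ℂ) :
    taylorTerm a m (fun v => -F v) = -taylorTerm a m F := by
  induction m generalizing F with
  | zero => simp only [taylorTerm, map_neg]
  | succ m ih => simp only [taylorTerm, pd_neg, ih, neg_mul, Finset.sum_neg_distrib]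

theorem taylorTerm_mem_evenPart (ha : ∀ i, a i ∈ evenPart L) (m : ℕ) (F : (Fin k → ℝ) → ℂ) :
    taylorTerm a m F ∈ evenPart L := by
  induction m generalizing F with
  | zero => exact (evenPart L).algebraMap_mem _
  | succ m ih => exact sum_mem fun i _ => mul_mem (ih _) (soul_mem_evenPart (ha i))

theorem taylorTerm_mem_degreeGE (ha : ∀ i, a i ∈ evenPart L) (m : ℕ) (F : (Fin k → ℝ) → ℂ) :
    taylorTerm a m F ∈ degreeGE L (2 * m) := by
  induction m generalizing F with
  | zero => trivial
  | succ m ih =>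
    exact sum_mem_degreeGE _ fun i _ => mul_mem_degreeGE (ih _) (soul_mem_degreeGE (ha i))

theorem evalEven_congr (hV : IsOpen V) (ha : realBody a ∈ V) (h : Set.EqOn F G V) :
    evalEven F a = evalEven G a :=
  Finset.sum_congr rfl fun m _ => by rw [taylorTerm_congr hV ha m h]

theorem evalEven_add (hV : IsOpen V) (ha : realBody a ∈ V) (hF : ContDiffOn ℝ ∞ F V)
    (hG : ContDiffOn ℝ ∞ G V) :
    evalEven (fun v => F v + G v) a = evalEven F a + evalEven G a := by
  simp only [evalEven]
  rw [← Finset.sum_add_distrib]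
  exact Finset.sum_congr rfl fun m _ => by rw [taylorTerm_add hV ha m hF hG, smul_add]

theorem evalEven_neg (F : (Fin k → ℝ) → ℂ) :
    evalEven (fun v => -F v) a = -evalEven F a := by
  simp only [evalEven, taylorTerm_neg, smul_neg, Finset.sum_neg_distrib]

theorem evalEven_zero : evalEven (fun _ => 0) a = 0 := by
  have h := evalEven_neg (a := a) (fun _ => 0)
  rw [neg_zero] at h
  have h2 : (2 : ℂ) • evalEven (fun _ => (0 : ℂ)) a = 0 := by
    rw [two_smul]; nth_rewrite 1 [h]; exact neg_add_cancel _
  exact (smul_eq_zero.1 h2).resolve_left two_ne_zero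

theorem evalEven_sum {ι : Type*} (t : Finset ι) {F : ι → (Fin k → ℝ) → ℂ} (hV : IsOpen V)
    (ha : realBody a ∈ V) (hF : ∀ j, ContDiffOn ℝ ∞ (F j) V) :
    evalEven (fun v => ∑ j ∈ t, F j v) a = ∑ j ∈ t, evalEven (F j) a := by
  classical
  induction t using Finset.induction_on with
  | empty => simp only [Finset.sum_empty, evalEven_zero]
  | insert j t hj ih =>
    simp only [Finset.sum_insert hj]
    rw [evalEven_add hV ha (hF j) (ContDiffOn.sum fun i _ => hF i), ih]

theorem evalEven_mem_evenPart (ha : ∀ i, a i ∈ evenPart L) (F : (Fin k → ℝ) → ℂ) :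
    evalEven F a ∈ evenPart L :=
  sum_mem fun m _ => (evenPart L).smul_mem (taylorTerm_mem_evenPart ha m F) _

theorem body_evalEven (ha : ∀ i, a i ∈ evenPart L) (F : (Fin k → ℝ) → ℂ) :
    body (evalEven F a) = F (realBody a) := by
  rw [evalEven, Finset.sum_range_succ', body_add, body_sum, Finset.sum_eq_zero, zero_add]
  · simp [taylorTerm, body_algebraMap]
  · intro m _
    have := (degreeGE_anti (m := 1) (by omega) (taylorTerm_mem_degreeGE ha (m + 1) F)).1
    rw [body_smul, this, mul_zero]

theorem sum_taylorTerm_pd_mul_soul (hV : IsOpen V) (ha : realBody a ∈ V)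
    (hF : ContDiffOn ℝ ∞ F V) (m : ℕ) (j : Fin k) :
    ∑ i, taylorTerm a m (pd j (pd i F)) * soul (a i) = taylorTerm a (m + 1) (pd j F) :=
  Finset.sum_congr rfl fun i _ => by rw [taylorTerm_congr hV ha m (pd_comm hV hF j i)]

/-- The chain rule for the terms of the Taylor expansion. `D m F` stands for the derivative of
`taylorTerm a m F`, `β i` for that of the body of `a i` and `σ i` for that of its soul. For `m = 0`
the truncated index `m - 1` is harmless, since the first sum has the coefficient zero. -/
theorem taylorTerm_chain_rule (hV : IsOpen V) (ha : realBody a ∈ V)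
    (heven : ∀ i, a i ∈ evenPart L) {D : ℕ → ((Fin k → ℝ) → ℂ) → Grassmann L}
    {β σ : Fin k → Grassmann L}
    (h0 : ∀ F, ContDiffOn ℝ ∞ F V → D 0 F = ∑ i, taylorTerm a 0 (pd i F) * β i)
    (hs : ∀ m F, ContDiffOn ℝ ∞ F V → D (m + 1) F
      = ∑ i, (D m (pd i F) * soul (a i) + taylorTerm a m (pd i F) * σ i))
    (m : ℕ) (hF : ContDiffOn ℝ ∞ F V) :
    D m F = (m : ℂ) • ∑ i, taylorTerm a (m - 1) (pd i F) * σ i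
      + ∑ i, taylorTerm a m (pd i F) * β i := by
  induction m generalizing F with
  | zero => rw [h0 F hF, Nat.cast_zero, zero_smul, zero_add]
  | succ m ih =>
    -- Even souls commute with everything, and the sums over the two indices may be interchanged.
    have hcomm : ∀ (n : ℕ) (τ : Fin k → Grassmann L),
        ∑ i, (∑ j, taylorTerm a n (pd j (pd i F)) * τ j) * soul (a i)
          = ∑ j, taylorTerm a (n + 1) (pd j F) * τ j := by
      intro n τ
      simp only [Finset.sum_mul]
      rw [Finset.sum_comm]
      refine Finset.sum_congr rfl fun j _ => ?_
      rw [← sum_taylorTerm_pd_mul_soul hV ha hF n j, Finset.sum_mul]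
      refine Finset.sum_congr rfl fun i _ => ?_
      rw [mul_assoc, mul_assoc, even_mul_comm (soul_mem_evenPart (heven i))]
    rw [hs m F hF, Finset.sum_add_distrib]
    have hstep : ∑ i, D m (pd i F) * soul (a i)
        = (m : ℂ) • ∑ i, taylorTerm a m (pd i F) * σ i
          + ∑ i, taylorTerm a (m + 1) (pd i F) * β i := by
      rw [← hcomm m β]
      have h1 : ∀ i, D m (pd i F) * soul (a i)
          = (m : ℂ) • ((∑ j, taylorTerm a (m - 1) (pd j (pd i F)) * σ j) * soul (a i))
            + (∑ j, taylorTerm a m (pd j (pd i F)) * β j) * soul (a i) := by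
        intro i
        rw [ih (pd_smooth hV hF i), add_mul, smul_mul_assoc]
      simp only [h1]
      rw [Finset.sum_add_distrib, ← Finset.smul_sum, hcomm (m - 1) σ]
      rcases m with _ | m
      · simp
      · rfl
    rw [hstep, Nat.add_sub_cancel, Nat.cast_succ, add_smul, one_smul]
    abel

/-- The chain rule for `evalEven`, in the notation of `taylorTerm_chain_rule`. The hypothesis `hσ`
says that the souls and their derivatives are nilpotent, so that truncation does no harm. -/
theorem evalEven_chain_rule (hV : IsOpen V) (ha : realBody a ∈ V)
    (heven : ∀ i, a i ∈ evenPart L) {D : ℕ → ((Fin k → ℝ) → ℂ) → Grassmann L}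
    {β σ : Fin k → Grassmann L}
    (h0 : ∀ F, ContDiffOn ℝ ∞ F V → D 0 F = ∑ i, taylorTerm a 0 (pd i F) * β i)
    (hs : ∀ m F, ContDiffOn ℝ ∞ F V → D (m + 1) F
      = ∑ i, (D m (pd i F) * soul (a i) + taylorTerm a m (pd i F) * σ i))
    (hσ : ∀ i, σ i ∈ degreeGE L 1) (hF : ContDiffOn ℝ ∞ F V) :
    ∑ m ∈ Finset.range (L + 1), (1 / (m.factorial : ℂ)) • D m F
      = ∑ i, evalEven (pd i F) a * (σ i + β i) := by
  have htop : ∀ i, taylorTerm a L (pd i F) * σ i = 0 := fun i =>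
    eq_zero_of_mem_degreeGE (Nat.lt_succ_self _)
      (mul_mem_degreeGE (taylorTerm_mem_degreeGE heven L (pd i F)) (hσ i))
  have h1 : ∀ m, (1 / (m.factorial : ℂ)) • D m F
      = (1 / (m.factorial : ℂ)) • (m : ℂ) • ∑ i, taylorTerm a (m - 1) (pd i F) * σ i
        + (1 / (m.factorial : ℂ)) • ∑ i, taylorTerm a m (pd i F) * β i := fun m => by
    rw [taylorTerm_chain_rule hV ha heven h0 hs m hF, smul_add]
  simp only [h1]
  rw [Finset.sum_add_distrib, Finset.sum_range_succ']
  have h2 : ∀ m : ℕ, (1 / ((m + 1).factorial : ℂ)) • ((m + 1 : ℕ) : ℂ) •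
      ∑ i, taylorTerm a (m + 1 - 1) (pd i F) * σ i
        = (1 / (m.factorial : ℂ)) • ∑ i, taylorTerm a m (pd i F) * σ i := by
    intro m
    have h3 : (m.factorial : ℂ) ≠ 0 := Nat.cast_ne_zero.2 m.factorial_ne_zero
    have h4 : ((m : ℂ) + 1) ≠ 0 := Nat.cast_add_one_ne_zero m
    rw [smul_smul, Nat.add_sub_cancel, Nat.factorial_succ]
    congr 1
    push_cast
    field_simp
  simp only [h2, Nat.cast_zero, zero_smul, smul_zero, add_zero]
  have h5 : ∀ i, evalEven (pd i F) a * (σ i + β i)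
      = ∑ m ∈ Finset.range L, (1 / (m.factorial : ℂ)) • (taylorTerm a m (pd i F) * σ i)
        + ∑ m ∈ Finset.range (L + 1),
          (1 / (m.factorial : ℂ)) • (taylorTerm a m (pd i F) * β i) := by
    intro i
    rw [mul_add, evalEven]
    simp only [Finset.sum_mul, smul_mul_assoc]
    rw [Finset.sum_range_succ, htop, smul_zero, add_zero]
  simp only [h5, Finset.smul_sum]
  rw [Finset.sum_add_distrib, Finset.sum_comm, Finset.sum_comm (s := Finset.range (L + 1))]

theorem gderiv_evalEven (hV : IsOpen V) (ha : realBody a ∈ V) (heven : ∀ i, a i ∈ evenPart L)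
    (hF : ContDiffOn ℝ ∞ F V) (s : Gen L) :
    gderiv s (evalEven F a) = ∑ i, evalEven (pd i F) a * gderiv s (a i) := by
  have h := evalEven_chain_rule hV ha heven (D := fun m F => gderiv s (taylorTerm a m F))
    (β := 0) (σ := fun i => gderiv s (a i)) (fun F _ => ?_) (fun m F _ => ?_) (fun i => ?_) hF
  · rw [evalEven, map_sum]
    simpa only [map_smul, Pi.zero_apply, add_zero] using h
  · simp [taylorTerm, gderiv_algebraMap]
  · simp only [taylorTerm, map_sum]
    refine Finset.sum_congr rfl fun i _ => ?_
    rw [gderiv_mul_of_even s (taylorTerm_mem_evenPart heven m _), gderiv_soul]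
  · exact ⟨body_gderiv_of_even (heven i) s, fun _ => trivial⟩

/-- Evaluation at even elements is multiplicative. The defect `(F G)(a) - F(a) G(a)` has body zero,
and its derivatives are combinations of such defects: it has arbitrarily high degree. -/
theorem evalEven_mul (hV : IsOpen V) (ha : realBody a ∈ V) (heven : ∀ i, a i ∈ evenPart L)
    (hF : ContDiffOn ℝ ∞ F V) (hG : ContDiffOn ℝ ∞ G V) :
    evalEven (fun v => F v * G v) a = evalEven F a * evalEven G a := by
  have key : ∀ m : ℕ, ∀ F G : (Fin k → ℝ) → ℂ, ContDiffOn ℝ ∞ F V → ContDiffOn ℝ ∞ G V →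
      evalEven (fun v => F v * G v) a - evalEven F a * evalEven G a ∈ degreeGE L m := by
    intro m
    induction m with
    | zero => intros; trivial
    | succ m ih =>
      intro F G hF hG
      refine ⟨by simp only [body_sub, body_mul, body_evalEven heven, sub_self], fun s => ?_⟩
      have hrw : gderiv s (evalEven (fun v => F v * G v) a - evalEven F a * evalEven G a)
          = ∑ i, ((evalEven (fun v => pd i F v * G v) a - evalEven (pd i F) a * evalEven G a)
            + (evalEven (fun v => F v * pd i G v) a - evalEven F a * evalEven (pd i G) a))
              * gderiv s (a i) := by
        rw [map_sub, gderiv_mul_of_even s (evalEven_mem_evenPart heven F),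
          gderiv_evalEven hV ha heven (hF.mul hG), gderiv_evalEven hV ha heven hF,
          gderiv_evalEven hV ha heven hG, Finset.sum_mul, Finset.mul_sum,
          ← Finset.sum_add_distrib, ← Finset.sum_sub_distrib]
        refine Finset.sum_congr rfl fun i _ => ?_
        rw [evalEven_congr hV ha (pd_mul hV hF hG i),
          evalEven_add hV ha ((pd_smooth hV hF i).mul hG) (hF.mul (pd_smooth hV hG i)),
          mul_assoc, ← even_mul_comm (evalEven_mem_evenPart heven G) (gderiv s (a i))]
        simp only [add_mul, sub_mul, mul_assoc]
        abel
      rw [hrw]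
      refine sum_mem_degreeGE _ fun i _ => ?_
      exact mul_mem_degreeGE (n := 0) (add_mem_degreeGE (ih _ _ (pd_smooth hV hF i) hG)
        (ih _ _ hF (pd_smooth hV hG i))) trivial
  exact sub_eq_zero.1 (eq_zero_of_mem_degreeGE (Nat.lt_succ_self _) (key _ F G hF hG))

/-- Evaluation at even elements is compatible with composition; the proof is that of
`evalEven_mul`. -/
theorem evalEven_comp {p : ℕ} {M : Set (Fin p → ℝ)} {φ : (Fin p → ℝ) → ℂ}
    {e : (Fin k → ℝ) → Fin p → ℝ} (hV : IsOpen V) (hM : IsOpen M) (hφ : ContDiffOn ℝ ∞ φ M)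
    (he : ContDiffOn ℝ ∞ e V) (hmaps : Set.MapsTo e V M) (ha : realBody a ∈ V)
    (heven : ∀ i, a i ∈ evenPart L) :
    evalEven φ (fun j => evalEven (fun v => ((e v j : ℝ) : ℂ)) a)
      = evalEven (fun v => φ (e v)) a := by
  set b : Fin p → Grassmann L := fun j => evalEven (fun v => ((e v j : ℝ) : ℂ)) a with hb
  have hbe : ∀ j, b j ∈ evenPart L := fun j => evalEven_mem_evenPart heven _
  have hbody : realBody b = e (realBody a) := by
    ext j
    simp only [realBody, hb, body_evalEven heven, Complex.ofReal_re]
  have hbM : realBody b ∈ M := hbody ▸ hmaps ha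
  have hej : ∀ j, ContDiffOn ℝ ∞ (fun v => ((e v j : ℝ) : ℂ)) V := fun j =>
    Complex.ofRealCLM.contDiff.comp_contDiffOn (contDiffOn_pi.1 he j)
  have key : ∀ m : ℕ, ∀ φ : (Fin p → ℝ) → ℂ, ContDiffOn ℝ ∞ φ M →
      evalEven φ b - evalEven (fun v => φ (e v)) a ∈ degreeGE L m := by
    intro m
    induction m with
    | zero => intros; trivial
    | succ m ih =>
      intro φ hφ
      refine ⟨by rw [body_sub, body_evalEven heven, body_evalEven hbe, hbody, sub_self],
        fun s => ?_⟩
      have hcomp : ∀ ψ : (Fin p → ℝ) → ℂ, ContDiffOn ℝ ∞ ψ M →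
        ContDiffOn ℝ ∞ (fun v => ψ (e v)) V := fun ψ hψ => hψ.comp he hmaps
      have hrw : gderiv s (evalEven φ b - evalEven (fun v => φ (e v)) a)
          = ∑ j, (evalEven (pd j φ) b - evalEven (fun v => pd j φ (e v)) a)
              * gderiv s (b j) := by
        rw [map_sub, gderiv_evalEven hM hbM hbe hφ, gderiv_evalEven hV ha heven (hcomp φ hφ)]
        simp only [sub_mul]
        rw [Finset.sum_sub_distrib]
        congr 1
        simp only [hb, gderiv_evalEven hV ha heven (hej _), Finset.mul_sum]
        rw [Finset.sum_comm]
        refine Finset.sum_congr rfl fun i _ => ?_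
        rw [evalEven_congr hV ha (pd_comp hV hM hφ he hmaps i), evalEven_sum _ hV ha
          (fun j => (hcomp _ (pd_smooth hM hφ j)).mul (pd_smooth hV (hej j) i)), Finset.sum_mul]
        refine Finset.sum_congr rfl fun j _ => ?_
        rw [evalEven_mul hV ha heven (hcomp _ (pd_smooth hM hφ j)) (pd_smooth hV (hej j) i),
          mul_assoc]
      rw [hrw]
      exact sum_mem_degreeGE _ fun j _ =>
        mul_mem_degreeGE (n := 0) (ih _ (pd_smooth hM hφ j)) trivial
  exact sub_eq_zero.1 (eq_zero_of_mem_degreeGE (Nat.lt_succ_self _) (key _ φ hφ))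

end Evaluation

/-! ### Differential calculus of smooth superfunctions -/

section Superfunctions

variable {p L : ℕ} {U : Set (Fin p → ℝ)} {f u v : (Fin p → ℝ) → Grassmann L}

theorem coeff_ext {u v : Grassmann L} (h : ∀ S, coeff S u = coeff S v) : u = v :=
  (monomialBasis L).ext_elem h

/-- The body as a linear map. -/
def bodyLinear : Grassmann L →ₗ[ℂ] ℂ := ExteriorAlgebra.algebraMapInv.toLinearMap

theorem coeff_add (S : Finset (Gen L)) (u v : Grassmann L) :
    coeff S (u + v) = coeff S u + coeff S v := map_add ((monomialBasis L).coord S) u v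

theorem coeff_smul (S : Finset (Gen L)) (c : ℂ) (u : Grassmann L) :
    coeff S (c • u) = c * coeff S u := map_smul ((monomialBasis L).coord S) c u

theorem sum_coeff_smul (u : Grassmann L) : ∑ S, coeff S u • monomialBasis L S = u :=
  (monomialBasis L).sum_repr u

theorem linear_apply_eq_sum_coeff (ℓ : Grassmann L →ₗ[ℂ] ℂ) (u : Grassmann L) :
    ℓ u = ∑ S, coeff S u * ℓ (monomialBasis L S) := by
  conv_lhs => rw [← sum_coeff_smul u, map_sum]
  simp only [map_smul, smul_eq_mul]

theorem coeff_mul (S : Finset (Gen L)) (u v : Grassmann L) :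
    coeff S (u * v) = ∑ S₁, ∑ S₂, coeff S₁ u * coeff S₂ v *
      coeff S (monomialBasis L S₁ * monomialBasis L S₂) := by
  change ((monomialBasis L).coord S) (u * v) = _
  conv_lhs => rw [← sum_coeff_smul u, ← sum_coeff_smul v]
  simp only [Finset.sum_mul, Finset.mul_sum, smul_mul_assoc, mul_smul_comm, map_sum, map_smul,
    smul_eq_mul]
  rw [Finset.sum_comm]
  refine Finset.sum_congr rfl fun S₁ _ => Finset.sum_congr rfl fun S₂ _ => ?_
  change _ * (_ * coeff S _) = _
  ring

theorem coeff_spd (S : Finset (Gen L)) (i : Fin p) (f : (Fin p → ℝ) → Grassmann L)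
    (x : Fin p → ℝ) : coeff S (spd i f x) = pd i (fun y => coeff S (f y)) x := by
  simp only [coeff, spd]
  rw [Module.Basis.repr_sum_self]

theorem SuperSmoothOn.linear_comp (hf : SuperSmoothOn f U) (ℓ : Grassmann L →ₗ[ℂ] ℂ) :
    ContDiffOn ℝ ∞ (fun x => ℓ (f x)) U := by
  rw [funext fun x => linear_apply_eq_sum_coeff ℓ (f x)]
  exact ContDiffOn.sum fun S _ => (hf S).mul contDiffOn_const

theorem SuperSmoothOn.map (hf : SuperSmoothOn f U) (T : Module.End ℂ (Grassmann L)) :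
    SuperSmoothOn (fun x => T (f x)) U := fun S =>
  hf.linear_comp ((monomialBasis L).coord S ∘ₗ T)

theorem SuperSmoothOn.congr (hf : SuperSmoothOn f U) (h : Set.EqOn u f U) : SuperSmoothOn u U :=
  fun S => (hf S).congr fun x hx => by rw [h hx]

theorem SuperSmoothOn.add (hu : SuperSmoothOn u U) (hv : SuperSmoothOn v U) :
    SuperSmoothOn (fun x => u x + v x) U := fun S => by
  simp only [coeff_add]
  exact (hu S).add (hv S)

theorem SuperSmoothOn.smul (hu : SuperSmoothOn u U) (c : ℂ) :
    SuperSmoothOn (fun x => c • u x) U := fun S => by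
  simp only [coeff_smul]
  exact contDiffOn_const.mul (hu S)

theorem SuperSmoothOn.mul (hu : SuperSmoothOn u U) (hv : SuperSmoothOn v U) :
    SuperSmoothOn (fun x => u x * v x) U := fun S => by
  rw [funext fun x => coeff_mul S (u x) (v x)]
  exact ContDiffOn.sum fun S₁ _ => ContDiffOn.sum fun S₂ _ =>
    ((hu S₁).mul (hv S₂)).mul contDiffOn_const

theorem SuperSmoothOn.algebraMap {φ : (Fin p → ℝ) → ℂ} (hφ : ContDiffOn ℝ ∞ φ U) :
    SuperSmoothOn (fun x => algebraMap ℂ (Grassmann L) (φ x)) U := fun S => by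
  simp only [Algebra.algebraMap_eq_smul_one]
  simp only [coeff_smul]
  exact hφ.mul contDiffOn_const

theorem SuperSmoothOn.sum {ι : Type*} (t : Finset ι) {u : ι → (Fin p → ℝ) → Grassmann L}
    (hu : ∀ j, SuperSmoothOn (u j) U) : SuperSmoothOn (fun x => ∑ j ∈ t, u j x) U := by
  classical
  induction t using Finset.induction_on with
  | empty =>
    simpa using SuperSmoothOn.algebraMap (L := L) (U := U) (φ := fun _ => 0) contDiffOn_const
  | insert j t hj ih => simpa only [Finset.sum_insert hj] using (hu j).add ih

theorem SuperSmoothOn.spd (hU : IsOpen U) (hf : SuperSmoothOn f U) (i : Fin p) :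
    SuperSmoothOn (spd i f) U := fun S => by
  simp only [coeff_spd]
  exact pd_smooth hU (hf S) i

theorem spd_congr (hU : IsOpen U) (h : Set.EqOn u v U) (i : Fin p) :
    Set.EqOn (spd i u) (spd i v) U := fun x hx => coeff_ext fun S => by
  rw [coeff_spd, coeff_spd]
  exact pd_congr hU (fun y hy => by rw [h hy]) i hx

theorem linear_spd (hU : IsOpen U) (hf : SuperSmoothOn f U) (ℓ : Grassmann L →ₗ[ℂ] ℂ)
    (i : Fin p) {x : Fin p → ℝ} (hx : x ∈ U) :
    ℓ (spd i f x) = pd i (fun x => ℓ (f x)) x := by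
  rw [funext fun x => linear_apply_eq_sum_coeff ℓ (f x), linear_apply_eq_sum_coeff ℓ (spd i f x),
    pd_sum _ hU (fun S _ => (hf S).mul contDiffOn_const) i hx]
  refine Finset.sum_congr rfl fun S _ => ?_
  rw [pd_mul_const hU (hf S) _ i hx, coeff_spd]

theorem body_spd (hU : IsOpen U) (hf : SuperSmoothOn f U) (i : Fin p) {x : Fin p → ℝ}
    (hx : x ∈ U) : body (spd i f x) = pd i (fun x => body (f x)) x :=
  linear_spd hU hf bodyLinear i hx

theorem spd_map (hU : IsOpen U) (hf : SuperSmoothOn f U) (T : Module.End ℂ (Grassmann L))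
    (i : Fin p) {x : Fin p → ℝ} (hx : x ∈ U) :
    spd i (fun x => T (f x)) x = T (spd i f x) := coeff_ext fun S => by
  rw [coeff_spd]
  exact (linear_spd hU hf ((monomialBasis L).coord S ∘ₗ T) i hx).symm

theorem spd_add (hU : IsOpen U) (hu : SuperSmoothOn u U) (hv : SuperSmoothOn v U) (i : Fin p)
    {x : Fin p → ℝ} (hx : x ∈ U) : spd i (fun x => u x + v x) x = spd i u x + spd i v x :=
  coeff_ext fun S => by
  simp only [coeff_spd, coeff_add]
  exact pd_add hU (hu S) (hv S) i hx

theorem spd_smul (hU : IsOpen U) (hu : SuperSmoothOn u U) (c : ℂ) (i : Fin p)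
    {x : Fin p → ℝ} (hx : x ∈ U) : spd i (fun x => c • u x) x = c • spd i u x :=
  coeff_ext fun S => by
  rw [coeff_spd, coeff_smul, coeff_spd, funext fun x => coeff_smul S c (u x),
    pd_mul hU contDiffOn_const (hu S) i hx, pd_const]
  ring

theorem spd_algebraMap (hU : IsOpen U) {φ : (Fin p → ℝ) → ℂ} (hφ : ContDiffOn ℝ ∞ φ U)
    (i : Fin p) {x : Fin p → ℝ} (hx : x ∈ U) :
    spd i (fun x => algebraMap ℂ (Grassmann L) (φ x)) x
      = algebraMap ℂ (Grassmann L) (pd i φ x) := coeff_ext fun S => by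
  simp only [coeff_spd, Algebra.algebraMap_eq_smul_one, coeff_smul]
  exact pd_mul_const hU hφ _ i hx

theorem spd_mul (hU : IsOpen U) (hu : SuperSmoothOn u U) (hv : SuperSmoothOn v U) (i : Fin p)
    {x : Fin p → ℝ} (hx : x ∈ U) :
    spd i (fun x => u x * v x) x = spd i u x * v x + u x * spd i v x := coeff_ext fun S => by
  rw [coeff_spd, coeff_add, coeff_mul, coeff_mul, funext fun x => coeff_mul S (u x) (v x),
    pd_sum _ hU (fun S₁ _ => ContDiffOn.sum fun S₂ _ =>
    ((hu S₁).mul (hv S₂)).mul contDiffOn_const) i hx, ← Finset.sum_add_distrib]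
  refine Finset.sum_congr rfl fun S₁ _ => ?_
  rw [pd_sum _ hU (fun S₂ _ => ((hu S₁).mul (hv S₂)).mul contDiffOn_const) i hx,
    ← Finset.sum_add_distrib]
  refine Finset.sum_congr rfl fun S₂ _ => ?_
  rw [pd_mul_const hU ((hu S₁).mul (hv S₂)) _ i hx, coeff_spd, coeff_spd, ← add_mul]
  exact congrArg (· * _) (pd_mul hU (hu S₁) (hv S₂) i hx)

theorem spd_sum (hU : IsOpen U) {ι : Type*} (t : Finset ι) {u : ι → (Fin p → ℝ) → Grassmann L}
    (hu : ∀ j, SuperSmoothOn (u j) U) (i : Fin p) {x : Fin p → ℝ} (hx : x ∈ U) :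
    spd i (fun x => ∑ j ∈ t, u j x) x = ∑ j ∈ t, spd i (u j) x := by
  classical
  induction t using Finset.induction_on with
  | empty =>
    simpa [pd_const] using spd_algebraMap (L := L) hU (φ := fun _ => 0) contDiffOn_const i hx
  | insert j t hj ih =>
    simp only [Finset.sum_insert hj]
    rw [spd_add hU (hu j) (SuperSmoothOn.sum t hu) i hx, ih]

theorem SuperSmoothOn.body (hf : SuperSmoothOn f U) :
    ContDiffOn ℝ ∞ (fun x => body (f x)) U :=
  hf.linear_comp bodyLinear

theorem SuperSmoothOn.soul (hf : SuperSmoothOn f U) : SuperSmoothOn (fun x => soul (f x)) U :=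
  (hf.add ((SuperSmoothOn.algebraMap hf.body).smul (-1))).congr fun x _ => by
    simp only [FlatSuper.soul, neg_one_smul, sub_eq_add_neg]

end Superfunctions

/-! ### The super-Laplacian of a function of the radial variables -/

section Radial

theorem sum_rotate {ι κ A : Type*} [Fintype ι] [Fintype κ] [AddCommMonoid A]
    (f : ι → ι → κ → A) : ∑ i, ∑ j, ∑ n, f i j n = ∑ n, ∑ i, ∑ j, f i j n := by
  rw [Finset.sum_comm (s := (Finset.univ : Finset κ))]
  exact Finset.sum_congr rfl fun i _ => Finset.sum_comm

variable {p k L : ℕ} {U : Set (Fin p → ℝ)} {V : Set (Fin k → ℝ)}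
  {ρ : (Fin p → ℝ) → Fin k → Grassmann L} {F : (Fin k → ℝ) → ℂ}

theorem IsEvenMap.smooth_realBody (hρ : IsEvenMap ρ U V) :
    ContDiffOn ℝ ∞ (fun x => realBody (ρ x)) U :=
  contDiffOn_pi.2 fun i => Complex.reCLM.contDiff.comp_contDiffOn (hρ.smooth i).body

theorem SuperSmoothOn.taylorTerm (hV : IsOpen V) (hρ : IsEvenMap ρ U V)
    (hF : ContDiffOn ℝ ∞ F V) (m : ℕ) : SuperSmoothOn (fun x => taylorTerm (ρ x) m F) U := by
  induction m generalizing F with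
  | zero => exact SuperSmoothOn.algebraMap (hF.comp hρ.smooth_realBody hρ.mapsTo)
  | succ m ih => exact SuperSmoothOn.sum _ fun i => (ih (pd_smooth hV hF i)).mul (hρ.smooth i).soul

theorem SuperSmoothOn.evalEven (hV : IsOpen V) (hρ : IsEvenMap ρ U V)
    (hF : ContDiffOn ℝ ∞ F V) : SuperSmoothOn (fun x => evalEven F (ρ x)) U :=
  SuperSmoothOn.sum _ fun m => (SuperSmoothOn.taylorTerm hV hρ hF m).smul _

theorem spd_evalEven (hU : IsOpen U) (hV : IsOpen V) (hρ : IsEvenMap ρ U V)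
    (hF : ContDiffOn ℝ ∞ F V) (n : Fin p) {x : Fin p → ℝ} (hx : x ∈ U) :
    spd n (fun x => evalEven F (ρ x)) x
      = ∑ i, evalEven (pd i F) (ρ x) * spd n (fun y => ρ y i) x := by
  have hbody : ∀ i, Set.EqOn (fun y => ((realBody (ρ y) i : ℝ) : ℂ)) (fun y => body (ρ y i)) U :=
    fun i y hy => Complex.ext rfl (hρ.real y hy i).symm
  have h := evalEven_chain_rule hV (hρ.mapsTo x hx) (hρ.even x hx)
    (D := fun m F => spd n (fun y => taylorTerm (ρ y) m F) x)
    (β := fun i => algebraMap ℂ (Grassmann L) (pd n (fun y => body (ρ y i)) x))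
    (σ := fun i => spd n (fun y => soul (ρ y i)) x) (fun F hF => ?_) (fun m F hF => ?_)
    (fun i => ?_) hF
  · have hs : ∀ m : ℕ, SuperSmoothOn (fun y => taylorTerm (ρ y) m F) U := fun m =>
      SuperSmoothOn.taylorTerm hV hρ hF m
    have h1 : spd n (fun y => evalEven F (ρ y)) x
        = ∑ m ∈ Finset.range (L + 1), (1 / (m.factorial : ℂ)) •
            spd n (fun y => taylorTerm (ρ y) m F) x := by
      simp only [evalEven]
      rw [spd_sum hU _ (u := fun m y => (1 / (m.factorial : ℂ)) • taylorTerm (ρ y) m F)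
        (fun m => (hs m).smul _) n hx]
      exact Finset.sum_congr rfl fun m _ => spd_smul hU (hs m) _ n hx
    rw [h1, h]
    refine Finset.sum_congr rfl fun i _ => ?_
    congr 1
    rw [← spd_algebraMap hU (hρ.smooth i).body n hx,
      ← spd_add hU (hρ.smooth i).soul (SuperSmoothOn.algebraMap (hρ.smooth i).body) n hx]
    simp only [soul, sub_add_cancel]
  · simp only [taylorTerm]
    rw [spd_algebraMap hU (φ := fun y => F (realBody (ρ y)))
      (hF.comp hρ.smooth_realBody hρ.mapsTo) n hx]
    rw [pd_comp hU hV hF hρ.smooth_realBody hρ.mapsTo n hx, map_sum]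
    refine Finset.sum_congr rfl fun i _ => ?_
    rw [map_mul, pd_congr hU (hbody i) n hx]
  · simp only [taylorTerm]
    have hs : ∀ i, SuperSmoothOn (fun y => taylorTerm (ρ y) m (pd i F)) U := fun i =>
      SuperSmoothOn.taylorTerm hV hρ (pd_smooth hV hF i) m
    rw [spd_sum hU _ (fun i => (hs i).mul (hρ.smooth i).soul) n hx]
    exact Finset.sum_congr rfl fun i _ => spd_mul hU (hs i) (hρ.smooth i).soul n hx
  · refine ⟨?_, fun _ => trivial⟩
    have := body_spd hU (hρ.smooth i).soul n hx
    simp only [body_soul, pd_const] at this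
    exact this

theorem lapS_evalEven (g : Fin p → ℝ) (h : Fin L → ℂ) (hU : IsOpen U) (hV : IsOpen V)
    (hρ : IsEvenMap ρ U V) (hF : ContDiffOn ℝ ∞ F V) {x : Fin p → ℝ} (hx : x ∈ U) :
    lapS g h (fun y => evalEven F (ρ y)) x
      = ∑ i, ∑ j, evalEven (pd i (pd j F)) (ρ x) *
          gradInner g h (fun y => ρ y i) (fun y => ρ y j) x
        + ∑ i, evalEven (pd i F) (ρ x) * lapS g h (fun y => ρ y i) x := by
  have ha := hρ.mapsTo x hx
  have heven := hρ.even x hx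
  have hpd : ∀ i, ContDiffOn ℝ ∞ (pd i F) V := pd_smooth hV hF
  set H : Fin k → Fin k → Grassmann L := fun i j => evalEven (pd i (pd j F)) (ρ x) with hH
  have hsymm : ∀ i j, H i j = H j i := fun i j => evalEven_congr hV ha (pd_comm hV hF i j)
  have hx2 : ∀ n, spd n (spd n (fun y => evalEven F (ρ y))) x
      = ∑ i, ∑ j, H i j * (spd n (fun y => ρ y i) x * spd n (fun y => ρ y j) x)
        + ∑ i, evalEven (pd i F) (ρ x) * spd n (spd n (fun y => ρ y i)) x := by
    intro n
    have hs : ∀ i, SuperSmoothOn (fun y => evalEven (pd i F) (ρ y)) U := fun i =>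
      SuperSmoothOn.evalEven hV hρ (hpd i)
    rw [spd_congr hU (fun y hy => spd_evalEven hU hV hρ hF n hy) n hx,
      spd_sum hU _ (fun i => (hs i).mul ((hρ.smooth i).spd hU n)) n hx, Finset.sum_comm,
      ← Finset.sum_add_distrib]
    refine Finset.sum_congr rfl fun j _ => ?_
    rw [spd_mul hU (hs j) ((hρ.smooth j).spd hU n) n hx,
      spd_evalEven hU hV hρ (hpd j) n hx, Finset.sum_mul]
    simp only [hH, mul_assoc]
  have hη2 : ∀ m, gderiv (etaStarIdx m) (gderiv (etaIdx m) (evalEven F (ρ x)))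
      = ∑ i, ∑ j, H i j * (gderiv (etaStarIdx m) (ρ x i) * gderiv (etaIdx m) (ρ x j))
        + ∑ i, evalEven (pd i F) (ρ x) *
            gderiv (etaStarIdx m) (gderiv (etaIdx m) (ρ x i)) := by
    intro m
    rw [gderiv_evalEven hV ha heven hF, map_sum, Finset.sum_comm, ← Finset.sum_add_distrib]
    refine Finset.sum_congr rfl fun j _ => ?_
    rw [gderiv_mul_of_even _ (evalEven_mem_evenPart heven _),
      gderiv_evalEven hV ha heven (hpd j), Finset.sum_mul]
    simp only [hH, mul_assoc]
  -- Derivatives of even elements anticommute, and the coefficients are symmetric in `i` and `j`.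
  have hgrad : ∀ m, ∑ i, ∑ j, H i j *
        (gderiv (etaStarIdx m) (ρ x i) * gderiv (etaIdx m) (ρ x j)
          - gderiv (etaIdx m) (ρ x i) * gderiv (etaStarIdx m) (ρ x j))
      = (2 : ℂ) • ∑ i, ∑ j, H i j *
        (gderiv (etaStarIdx m) (ρ x i) * gderiv (etaIdx m) (ρ x j)) := by
    intro m
    have h1 : ∀ i j, H i j * (gderiv (etaStarIdx m) (ρ x i) * gderiv (etaIdx m) (ρ x j)
          - gderiv (etaIdx m) (ρ x i) * gderiv (etaStarIdx m) (ρ x j))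
        = H i j * (gderiv (etaStarIdx m) (ρ x i) * gderiv (etaIdx m) (ρ x j))
          + H j i * (gderiv (etaStarIdx m) (ρ x j) * gderiv (etaIdx m) (ρ x i)) := by
      intro i j
      rw [gderiv_even_anticomm (heven i) (heven j) (etaIdx m), sub_neg_eq_add, mul_add,
        hsymm j i]
    simp only [h1, Finset.sum_add_distrib]
    rw [two_smul]
    congr 1
    rw [Finset.sum_comm]
  have hgradInner : ∑ i, ∑ j, H i j * gradInner g h (fun y => ρ y i) (fun y => ρ y j) x
      = ∑ n, (1 / g n : ℂ) •
          ∑ i, ∑ j, H i j * (spd n (fun y => ρ y i) x * spd n (fun y => ρ y j) x)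
        + (2 : ℂ) • ∑ m, (1 / h m) • ∑ i, ∑ j, H i j *
          (gderiv (etaStarIdx m) (ρ x i) * gderiv (etaIdx m) (ρ x j)) := by
    have e1 : ∀ m, (2 : ℂ) • (1 / h m) • ∑ i, ∑ j, H i j *
          (gderiv (etaStarIdx m) (ρ x i) * gderiv (etaIdx m) (ρ x j))
        = (1 / h m) • ∑ i, ∑ j, H i j *
          (gderiv (etaStarIdx m) (ρ x i) * gderiv (etaIdx m) (ρ x j)
            - gderiv (etaIdx m) (ρ x i) * gderiv (etaStarIdx m) (ρ x j)) := fun m => by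
      rw [hgrad, smul_comm]
    rw [Finset.smul_sum, Finset.sum_congr rfl fun m _ => e1 m]
    simp only [gradInner, mul_add, Finset.mul_sum, mul_smul_comm, Finset.sum_add_distrib,
      Finset.smul_sum]
    congr 1
    · exact sum_rotate _
    · exact sum_rotate _
  have hlap : ∑ i, evalEven (pd i F) (ρ x) * lapS g h (fun y => ρ y i) x
      = ∑ n, (1 / g n : ℂ) •
          ∑ i, evalEven (pd i F) (ρ x) * spd n (spd n (fun y => ρ y i)) x
        + (2 : ℂ) • ∑ m, (1 / h m) • ∑ i, evalEven (pd i F) (ρ x) *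
            gderiv (etaStarIdx m) (gderiv (etaIdx m) (ρ x i)) := by
    simp only [lapS, mul_add, Finset.mul_sum, mul_smul_comm, Finset.sum_add_distrib,
      Finset.smul_sum]
    congr 1 <;> rw [Finset.sum_comm]
  rw [hgradInner, hlap]
  simp only [lapS, hx2, hη2, smul_add, Finset.sum_add_distrib]
  abel

end Radial

/-! ### The Berezin integral as a power of the Grassmann Laplacian -/

section Berezin

theorem add_pow_succ_of_sq_eq_zero {R : Type*} [Semiring R] {x y : R} (hxy : Commute x y)
    (hx : x * x = 0) (n : ℕ) : (x + y) ^ (n + 1) = y ^ (n + 1) + (n + 1) • (x * y ^ n) := by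
  induction n with
  | zero => simp [add_comm]
  | succ n ih =>
    have h1 : y ^ (n + 1) * x = x * y ^ (n + 1) := ((hxy.pow_right (n + 1)).eq).symm
    have h2 : x * y ^ n * x = 0 := by
      rw [mul_assoc, ← (hxy.pow_right n).eq, ← mul_assoc, hx, zero_mul]
    rw [pow_succ, ih, add_mul, mul_add, mul_add, smul_mul_assoc, smul_mul_assoc, h1, h2,
      mul_assoc x, ← pow_succ, ← pow_succ, smul_zero, zero_add, succ_nsmul _ (n + 1)]
    abel

/-- The multinomial theorem for commuting elements with square zero. The second identity serves
the induction. -/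
theorem sum_pow_of_sq_eq_zero {R : Type*} [Semiring R] {n : ℕ} (x : Fin n → R)
    (hc : ∀ i j, Commute (x i) (x j)) (hsq : ∀ i, x i * x i = 0) :
    (∑ i, x i) ^ n = n.factorial • (List.ofFn x).prod ∧ (∑ i, x i) ^ (n + 1) = 0 := by
  induction n with
  | zero => simp
  | succ n ih =>
    obtain ⟨h1, h2⟩ := ih (fun i => x i.succ) (fun i j => hc _ _) (fun i => hsq _)
    have hxy : Commute (x 0) (∑ i : Fin n, x i.succ) := Commute.sum_right _ _ _ fun i _ => hc _ _
    rw [Fin.sum_univ_succ]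
    constructor
    · rw [add_pow_succ_of_sq_eq_zero hxy (hsq 0), h2, zero_add, h1, List.ofFn_succ,
        List.prod_cons, mul_smul_comm, smul_smul, Nat.factorial_succ]
    · rw [add_pow_succ_of_sq_eq_zero hxy (hsq 0), pow_succ, h2, zero_mul, mul_zero, smul_zero,
        add_zero]

theorem prod_ofFn_smul {A : Type*} [Semiring A] [Algebra ℂ A] {n : ℕ} (c : Fin n → ℂ)
    (y : Fin n → A) :
    (List.ofFn fun i => c i • y i).prod = (∏ i, c i) • (List.ofFn y).prod := by
  induction n with
  | zero => simp
  | succ n ih =>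
    rw [List.ofFn_succ, List.ofFn_succ, List.prod_cons, List.prod_cons, ih, Fin.prod_univ_succ,
      smul_mul_smul_comm]

variable {L : ℕ}

/-- The second derivative `∂²/(∂η_m^* ∂η_m)`. -/
def pairDeriv (m : Fin L) : Module.End ℂ (Grassmann L) := gderiv (etaStarIdx m) * gderiv (etaIdx m)

/-- The Grassmann part `2 ∑_m h_m⁻¹ ∂²/(∂η_m^* ∂η_m)` of the super-Laplacian. -/
def lapEta (h : Fin L → ℂ) : Module.End ℂ (Grassmann L) :=
  (2 : ℂ) • ∑ m, (1 / h m) • pairDeriv m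

theorem gderiv_mul_gderiv (s t : Gen L) :
    (gderiv s * gderiv t : Module.End ℂ (Grassmann L)) = (-1 : ℂ) • (gderiv t * gderiv s) :=
  LinearMap.ext fun u => (gderiv_comm s t u).trans (neg_one_smul ℂ _).symm

theorem pairDeriv_apply (m : Fin L) (u : Grassmann L) :
    pairDeriv m u = gderiv (etaStarIdx m) (gderiv (etaIdx m) u) := rfl

theorem pairDeriv_commute (m n : Fin L) : Commute (pairDeriv m) (pairDeriv n) := by
  have key : ∀ (s t q : Gen L) (u : Grassmann L),
      gderiv s (gderiv t (gderiv q u)) = gderiv q (gderiv s (gderiv t u)) := fun s t q u => by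
    rw [gderiv_comm t q u, map_neg, gderiv_comm s q, neg_neg]
  refine LinearMap.ext fun u => ?_
  simp only [Module.End.mul_apply, pairDeriv_apply]
  rw [key _ _ (etaStarIdx n), key _ _ (etaIdx n) u]

theorem pairDeriv_mul_self (m : Fin L) : pairDeriv m * pairDeriv m = 0 := by
  refine LinearMap.ext fun u => ?_
  rw [Module.End.mul_apply, pairDeriv_apply, pairDeriv_apply, gderiv_comm (etaIdx m), map_neg,
    gderiv_gderiv_self, neg_zero]
  rfl

theorem berezinOne_mul_berezinOne (m : Fin L) :
    berezinOne (etaIdx m) * berezinOne (etaStarIdx m)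
      = (-(1 / (2 * Real.pi)) : ℂ) • pairDeriv m := by
  have hc : (((1 / Real.sqrt (2 * Real.pi) : ℝ) : ℂ)) * (((1 / Real.sqrt (2 * Real.pi) : ℝ) : ℂ))
      = (1 / (2 * Real.pi) : ℂ) := by
    rw [← Complex.ofReal_mul, div_mul_div_comm, one_mul, Real.mul_self_sqrt (by positivity)]
    push_cast
    rfl
  rw [berezinOne, berezinOne, smul_mul_smul_comm, hc, gderiv_mul_gderiv, smul_smul, mul_neg_one,
    pairDeriv]

theorem berezin_eq_body_lapEta_pow (h : Fin L → ℂ) (hh : ∀ m, h m ≠ 0) (u : Grassmann L) :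
    berezin u = (∏ m, h m) / ((L.factorial : ℂ) * (4 * (Real.pi : ℂ)) ^ L)
      * body ((((-1 : ℂ) • lapEta h) ^ L) u) := by
  have h1 : (List.ofFn fun m : Fin L => berezinOne (etaIdx m) * berezinOne (etaStarIdx m)).prod
      = (-(1 / (2 * Real.pi)) : ℂ) ^ L • (List.ofFn fun m : Fin L => pairDeriv m).prod := by
    simp only [berezinOne_mul_berezinOne]
    rw [prod_ofFn_smul (fun _ => (-(1 / (2 * Real.pi)) : ℂ)) pairDeriv, Finset.prod_const,
      Finset.card_univ, Fintype.card_fin]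
  have h2 : ((-1 : ℂ) • lapEta h) ^ L = ((-2 : ℂ) ^ L * (L.factorial * ∏ m, (1 / h m))) •
      (List.ofFn fun m : Fin L => pairDeriv m).prod := by
    rw [lapEta, smul_smul, neg_one_mul, smul_pow,
      (sum_pow_of_sq_eq_zero (fun m => (1 / h m) • pairDeriv m)
      (fun i j => ((pairDeriv_commute i j).smul_left _).smul_right _)
      (fun i => by rw [smul_mul_smul_comm, pairDeriv_mul_self, smul_zero])).1, prod_ofFn_smul,
      ← Nat.cast_smul_eq_nsmul ℂ, smul_smul, smul_smul, mul_assoc]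
  have hprod : (∏ m, h m) * ∏ m, (1 / h m) = 1 := by
    rw [← Finset.prod_mul_distrib]
    exact Finset.prod_eq_one fun m _ => mul_one_div_cancel (hh m)
  have hfac : (L.factorial : ℂ) ≠ 0 := Nat.cast_ne_zero.2 L.factorial_ne_zero
  have hpi : (Real.pi : ℂ) ≠ 0 := Complex.ofReal_ne_zero.2 Real.pi_ne_zero
  rw [berezin, h1, h2, LinearMap.smul_apply, LinearMap.smul_apply, body_smul, body_smul,
    ← mul_assoc]
  congr 1
  have h3 : (-(1 / (2 * Real.pi)) : ℂ) ^ L = (-2 : ℂ) ^ L / (4 * (Real.pi : ℂ)) ^ L := by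
    rw [← div_pow]
    congr 1
    field_simp
    norm_num
  rw [h3]
  have h4 : (4 * (Real.pi : ℂ)) ^ L ≠ 0 := pow_ne_zero _ (mul_ne_zero (by norm_num) hpi)
  calc (-2 : ℂ) ^ L / (4 * (Real.pi : ℂ)) ^ L
      = (-2 : ℂ) ^ L / (4 * (Real.pi : ℂ)) ^ L * ((∏ m, h m) * ∏ m, (1 / h m)) := by
        rw [hprod, mul_one]
    _ = _ := by field_simp

end Berezin

/-! ### The two Laplacians as commuting operators on smooth superfunctions -/

section Operators

variable {p k L : ℕ} {W : Set (Fin p → ℝ)}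

/-- The space of superfunctions that are smooth over `W`. -/
def smoothSuper (L : ℕ) (W : Set (Fin p → ℝ)) : Submodule ℂ ((Fin p → ℝ) → Grassmann L) where
  carrier := {f | SuperSmoothOn f W}
  add_mem' hu hv := SuperSmoothOn.add hu hv
  zero_mem' := by
    simpa using! SuperSmoothOn.algebraMap (L := L) (U := W) (φ := fun _ => 0) contDiffOn_const
  smul_mem' c _ hu := SuperSmoothOn.smul hu c

open Classical in
/-- The partial derivative `∂/∂x_i` over `W`. It is set to zero outside `W`, where smoothness is not
assumed, so that it is a linear operator. -/
def spdOn (L : ℕ) (hW : IsOpen W) (i : Fin p) : Module.End ℂ (smoothSuper L W) where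
  toFun f := ⟨fun x => if x ∈ W then spd i f x else 0,
    (SuperSmoothOn.spd hW f.2 i).congr fun x hx => if_pos hx⟩
  map_add' u v := by
    ext1
    funext x
    by_cases hx : x ∈ W
    · exact (if_pos hx).trans ((spd_add hW u.2 v.2 i hx).trans
        (congrArg₂ (· + ·) (if_pos hx).symm (if_pos hx).symm))
    · exact (if_neg hx).trans ((add_zero _).symm.trans
        (congrArg₂ (· + ·) (if_neg hx).symm (if_neg hx).symm))
  map_smul' c u := by
    ext1
    funext x
    by_cases hx : x ∈ W
    · exact (if_pos hx).trans ((spd_smul hW u.2 c i hx).trans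
        (congrArg (c • ·) (if_pos hx).symm))
    · exact (if_neg hx).trans ((smul_zero c).symm.trans (congrArg (c • ·) (if_neg hx).symm))

theorem spdOn_apply (hW : IsOpen W) (i : Fin p) (f : smoothSuper L W) {x : Fin p → ℝ}
    (hx : x ∈ W) : (spdOn L hW i f).1 x = spd i f x := if_pos hx

/-- A linear operator on the Grassmann algebra acts on superfunctions. -/
def pointwise (W : Set (Fin p → ℝ)) (T : Module.End ℂ (Grassmann L)) :
    Module.End ℂ (smoothSuper L W) where
  toFun f := ⟨fun x => T (f.1 x), SuperSmoothOn.map f.2 T⟩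
  map_add' u v := by ext1; funext x; exact map_add T _ _
  map_smul' c u := by ext1; funext x; exact map_smul T _ _

theorem pointwise_pow_apply (T : Module.End ℂ (Grassmann L)) (n : ℕ) (f : smoothSuper L W)
    (x : Fin p → ℝ) : ((pointwise W T ^ n) f).1 x = (T ^ n) (f.1 x) := by
  induction n generalizing f with
  | zero => rfl
  | succ n ih => rw [pow_succ, pow_succ, Module.End.mul_apply, ih]; rfl

theorem spdOn_commute_pointwise (hW : IsOpen W) (i : Fin p) (T : Module.End ℂ (Grassmann L)) :
    Commute (spdOn L hW i) (pointwise W T) := by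
  refine LinearMap.ext fun u => Subtype.ext (funext fun x => ?_)
  by_cases hx : x ∈ W
  · refine (spdOn_apply hW i (pointwise W T u) hx).trans ((spd_map hW u.2 T i hx).trans ?_)
    exact congrArg T (spdOn_apply hW i u hx).symm
  · exact (if_neg hx).trans ((map_zero T).symm.trans (congrArg T (if_neg hx).symm))

/-- The operator `Δ_C` on superfunctions over `W`. -/
def lapCOn (L : ℕ) (hW : IsOpen W) (g : Fin p → ℝ) : Module.End ℂ (smoothSuper L W) :=
  ∑ n, (1 / g n : ℂ) • (spdOn L hW n * spdOn L hW n)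

/-- The operator `Δ_S` on superfunctions over `W`. -/
def lapSOn (hW : IsOpen W) (g : Fin p → ℝ) (h : Fin L → ℂ) : Module.End ℂ (smoothSuper L W) :=
  lapCOn L hW g + pointwise W (lapEta h)

theorem lapCOn_apply (hW : IsOpen W) (g : Fin p → ℝ) (f : smoothSuper L W) {x : Fin p → ℝ}
    (hx : x ∈ W) : (lapCOn L hW g f).1 x = ∑ n, (1 / g n : ℂ) • spd n (spd n f) x := by
  have h1 : (lapCOn L hW g f).1 x
      = ∑ n, (1 / g n : ℂ) • (spdOn L hW n (spdOn L hW n f)).1 x := by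
    simp [lapCOn, LinearMap.sum_apply, Finset.sum_apply]
  rw [h1]
  refine Finset.sum_congr rfl fun n _ => ?_
  rw [spdOn_apply hW n _ hx, spd_congr hW (fun y hy => spdOn_apply hW n f hy) n hx]

theorem lapSOn_apply (hW : IsOpen W) (g : Fin p → ℝ) (h : Fin L → ℂ) (f : smoothSuper L W)
    {x : Fin p → ℝ} (hx : x ∈ W) : (lapSOn hW g h f).1 x = lapS g h f x := by
  have h1 : lapEta h (f.1 x)
      = (2 : ℂ) • ∑ m, (1 / h m) • gderiv (etaStarIdx m) (gderiv (etaIdx m) (f.1 x)) := by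
    simp [lapEta, pairDeriv, LinearMap.sum_apply]
  exact congrArg₂ (· + ·) (lapCOn_apply hW g f hx) h1

theorem lapCOn_commute_lapSOn (hW : IsOpen W) (g : Fin p → ℝ) (h : Fin L → ℂ) :
    Commute (lapCOn L hW g) (lapSOn hW g h) := by
  have h1 : ∀ n, Commute ((1 / g n : ℂ) • (spdOn L hW n * spdOn L hW n))
      (pointwise W (lapEta h)) := fun n =>
    ((spdOn_commute_pointwise hW n _).mul_left (spdOn_commute_pointwise hW n _)).smul_left _
  have h2 : Commute (lapCOn L hW g) (pointwise W (lapEta h)) :=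
    Commute.sum_left _ _ _ fun n _ => h1 n
  exact (Commute.refl _).add_right h2

theorem lapC_congr (hW : IsOpen W) (g : Fin p → ℝ) {F G : (Fin p → ℝ) → ℂ} (h : Set.EqOn F G W) :
    Set.EqOn (lapC g F) (lapC g G) W := fun x hx =>
  Finset.sum_congr rfl fun n _ => by rw [pd_congr hW (pd_congr hW h n) n hx]

theorem lapC_iterate_congr (hW : IsOpen W) (g : Fin p → ℝ) (n : ℕ) {F G : (Fin p → ℝ) → ℂ}
    (h : Set.EqOn F G W) : Set.EqOn ((lapC g)^[n] F) ((lapC g)^[n] G) W := by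
  induction n generalizing F G with
  | zero => exact h
  | succ n ih => exact ih (lapC_congr hW g h)

theorem body_lapCOn (hW : IsOpen W) (g : Fin p → ℝ) (f : smoothSuper L W) :
    Set.EqOn (fun x => body ((lapCOn L hW g f).1 x)) (lapC g fun x => body (f.1 x)) W := by
  intro x hx
  simp only [lapCOn_apply hW g f hx, body_sum, body_smul, lapC]
  refine Finset.sum_congr rfl fun n _ => ?_
  rw [body_spd hW (SuperSmoothOn.spd hW f.2 n) n hx,
    pd_congr hW (fun y hy => body_spd hW f.2 n hy) n hx]

theorem body_lapCOn_pow (hW : IsOpen W) (g : Fin p → ℝ) (n : ℕ) (f : smoothSuper L W) :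
    Set.EqOn (fun x => body (((lapCOn L hW g ^ n) f).1 x))
      ((lapC g)^[n] fun x => body (f.1 x)) W := by
  induction n generalizing f with
  | zero => exact fun _ _ => rfl
  | succ n ih =>
    intro x hx
    rw [Function.iterate_succ_apply, ← lapC_iterate_congr hW g n (body_lapCOn hW g f) hx,
      pow_succ, Module.End.mul_apply]
    exact ih (lapCOn L hW g f) hx

theorem lapS_congr (hW : IsOpen W) (g : Fin p → ℝ) (h : Fin L → ℂ)
    {u v : (Fin p → ℝ) → Grassmann L} (huv : Set.EqOn u v W) :
    Set.EqOn (lapS g h u) (lapS g h v) W := fun x hx => by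
  have h1 : ∀ n, spd n (spd n u) x = spd n (spd n v) x := fun n =>
    spd_congr hW (spd_congr hW huv n) n hx
  simp only [lapS, huv hx, h1]

/-- The Grassmann part of `Δ_S` is the difference `Δ_S - Δ_C` of commuting operators, so that its
powers are given by the binomial theorem. -/
theorem pointwise_neg_lapEta_pow (hW : IsOpen W) (g : Fin p → ℝ) (h : Fin L → ℂ) (N : ℕ) :
    pointwise W ((-1 : ℂ) • lapEta h) ^ N = ∑ n ∈ Finset.range (N + 1),
      (N.choose n : ℂ) • (lapCOn L hW g ^ (N - n) * ((-1 : ℂ) • lapSOn hW g h) ^ n) := by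
  have h1 : pointwise W ((-1 : ℂ) • lapEta h) = (-1 : ℂ) • lapSOn hW g h + lapCOn L hW g := by
    refine LinearMap.ext fun u => Subtype.ext (funext fun x => ?_)
    change (-1 : ℂ) • lapEta h (u.1 x)
      = (-1 : ℂ) • ((lapCOn L hW g u).1 x + lapEta h (u.1 x)) + (lapCOn L hW g u).1 x
    rw [smul_add, neg_one_smul ℂ ((lapCOn L hW g u).1 x)]
    abel
  have hc : Commute ((-1 : ℂ) • lapSOn hW g h) (lapCOn L hW g) :=
    (lapCOn_commute_lapSOn hW g h).symm.smul_left _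
  rw [h1, hc.add_pow]
  refine Finset.sum_congr rfl fun n _ => ?_
  rw [(hc.pow_pow n (N - n)).eq, ← (Nat.cast_commute (N.choose n) _).eq, ← nsmul_eq_mul,
    Nat.cast_smul_eq_nsmul]

end Operators

/-! ### The radial part -/

section RadialPart

variable {p k L : ℕ} {W : Set (Fin p → ℝ)} {V : Set (Fin k → ℝ)}
  {ρ : (Fin p → ℝ) → Fin k → Grassmann L}
  {A : Fin k → Fin k → (Fin k → ℝ) → ℂ} {B : Fin k → (Fin k → ℝ) → ℂ}
  {g : Fin p → ℝ} {h : Fin L → ℂ} {F : (Fin k → ℝ) → ℂ}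

theorem radialOp_smooth (hV : IsOpen V) (hA : ∀ i j, ContDiffOn ℝ ∞ (A i j) V)
    (hB : ∀ i, ContDiffOn ℝ ∞ (B i) V) (hF : ContDiffOn ℝ ∞ F V) :
    ContDiffOn ℝ ∞ (radialOp A B F) V :=
  (ContDiffOn.sum fun i _ => ContDiffOn.sum fun j _ =>
      (hA i j).mul (pd_smooth hV (pd_smooth hV hF j) i)).add
    (ContDiffOn.sum fun i _ => (hB i).mul (pd_smooth hV hF i))

/-- On functions of the radial variables, `Δ_S` acts as its radial part. -/
theorem lapS_evalEven_eq_evalEven_radialOp (hW : IsOpen W) (hV : IsOpen V) (hρ : IsEvenMap ρ W V)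
    (hAB : IsRadialPart g h ρ W V A B) (hF : ContDiffOn ℝ ∞ F V) {x : Fin p → ℝ} (hx : x ∈ W) :
    lapS g h (fun y => evalEven F (ρ y)) x = evalEven (radialOp A B F) (ρ x) := by
  have ha := hρ.mapsTo x hx
  have heven := hρ.even x hx
  have h1 : ∀ i, ContDiffOn ℝ ∞ (pd i F) V := pd_smooth hV hF
  have h2 : ∀ i j, ContDiffOn ℝ ∞ (pd i (pd j F)) V := fun i j => pd_smooth hV (h1 j) i
  have h3 : ∀ i j, ContDiffOn ℝ ∞ (fun v => A i j v * pd i (pd j F) v) V := fun i j =>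
    (hAB.smooth_A i j).mul (h2 i j)
  have h4 : ∀ i, ContDiffOn ℝ ∞ (fun v => B i v * pd i F v) V := fun i =>
    (hAB.smooth_B i).mul (h1 i)
  unfold radialOp
  rw [lapS_evalEven g h hW hV hρ hF hx, evalEven_add hV ha
    (ContDiffOn.sum fun i _ => ContDiffOn.sum fun j _ => h3 i j) (ContDiffOn.sum fun i _ => h4 i),
    evalEven_sum _ hV ha (fun i => ContDiffOn.sum fun j _ => h3 i j), evalEven_sum _ hV ha h4]
  congr 1
  · refine Finset.sum_congr rfl fun i _ => ?_
    rw [evalEven_sum _ hV ha (h3 i)]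
    refine Finset.sum_congr rfl fun j _ => ?_
    rw [evalEven_mul hV ha heven (hAB.smooth_A i j) (h2 i j), hAB.second_order i j x hx,
      even_mul_comm (evalEven_mem_evenPart heven _)]
  · refine Finset.sum_congr rfl fun i _ => ?_
    rw [evalEven_mul hV ha heven (hAB.smooth_B i) (h1 i), hAB.first_order i x hx,
      even_mul_comm (evalEven_mem_evenPart heven _)]

theorem neg_lapSOn_pow_apply (hW : IsOpen W) (hV : IsOpen V) (hρ : IsEvenMap ρ W V)
    (hAB : IsRadialPart g h ρ W V A B) (n : ℕ) (hF : ContDiffOn ℝ ∞ F V) (f : smoothSuper L W)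
    (hf : Set.EqOn f.1 (fun x => evalEven F (ρ x)) W) :
    Set.EqOn ((((-1 : ℂ) • lapSOn hW g h) ^ n) f).1
      (fun x => evalEven ((fun G => -radialOp A B G)^[n] F) (ρ x)) W := by
  induction n generalizing F f with
  | zero => exact hf
  | succ n ih =>
    rw [pow_succ, Module.End.mul_apply]
    refine ih (F := -radialOp A B F) (radialOp_smooth hV hAB.smooth_A hAB.smooth_B hF).neg _ ?_
    intro x hx
    have h1 : (((-1 : ℂ) • lapSOn hW g h) f).1 x = -(lapSOn hW g h f).1 x :=
      neg_one_smul ℂ ((lapSOn hW g h f).1 x)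
    rw [h1, lapSOn_apply hW g h f hx, lapS_congr hW g h hf hx,
      lapS_evalEven_eq_evalEven_radialOp hW hV hρ hAB hF hx]
    exact (evalEven_neg _).symm

end RadialPart

end FlatSuper

end

open FlatSuper in
theorem theorem2p1 {p L k : ℕ} (g : Fin p → ℝ) (hg : ∀ n, 0 < g n)
    (h : Fin L → ℂ) (hh : ∀ m, h m ≠ 0)
    (M : Set (Fin p → ℝ)) (hM : IsOpen M)
    (r : (Fin p → ℝ) → Fin p → Grassmann L) (hr : IsEvenMap r M M)
    (W : Set (Fin p → ℝ)) (V : Set (Fin k → ℝ))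
    (ρ : (Fin p → ℝ) → Fin k → Grassmann L) (emb : (Fin k → ℝ) → Fin p → ℝ)
    (hρ : IsRadialVariables r ρ emb M W V)
    (A : Fin k → Fin k → (Fin k → ℝ) → ℂ) (B : Fin k → (Fin k → ℝ) → ℂ)
    (hAB : IsRadialPart g h ρ W V A B)
    (f : (Fin p → ℝ) → Grassmann L) (hf : SuperSmoothOn f M)
    (hinv : ∀ x ∈ M, f x = evalEven (fun y => body (f y)) (r x)) :
    ∀ x ∈ W, berezin (f x) = opDCS g h ρ A B (fun v => body (f (emb v))) x := by
  intro x hx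
  have hW := hρ.isOpen_W
  have hV := hρ.isOpen_V
  have hev := hρ.evenMap
  have hF : ContDiffOn ℝ ∞ (fun v => body (f (emb v))) V :=
    hf.body.comp hρ.smooth_emb hρ.mapsTo_emb
  let fW : smoothSuper L W := ⟨f, fun S => (hf S).mono hρ.subset⟩
  have hfW : Set.EqOn fW.1 (fun x => evalEven (fun v => body (f (emb v))) (ρ x)) W := by
    intro y hy
    have h1 : r y = fun j => evalEven (fun v => ((emb v j : ℝ) : ℂ)) (ρ y) :=
      funext fun j => hρ.factor y hy j
    change f y = _
    rw [hinv y (hρ.subset hy), h1, evalEven_comp hV hM hf.body hρ.smooth_emb hρ.mapsTo_emb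
      (hev.mapsTo y hy) (hev.even y hy)]
  rw [berezin_eq_body_lapEta_pow h hh, opDCS]
  congr 1
  have h2 : (((-1 : ℂ) • lapEta h) ^ L) (f x) = ∑ n ∈ Finset.range (L + 1),
      (L.choose n : ℂ) • ((lapCOn L hW g ^ (L - n)) ((((-1 : ℂ) • lapSOn hW g h) ^ n) fW)).1 x := by
    change (((-1 : ℂ) • lapEta h) ^ L) (fW.1 x) = _
    rw [← pointwise_pow_apply, pointwise_neg_lapEta_pow hW g h L]
    simp [LinearMap.sum_apply, Finset.sum_apply]
  rw [h2, body_sum]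
  refine Finset.sum_congr rfl fun n _ => ?_
  rw [body_smul]
  congr 1
  refine (body_lapCOn_pow hW g (L - n) _ hx).trans (lapC_iterate_congr hW g _ ?_ hx)
  intro y hy
  exact (congrArg body (neg_lapSOn_pow_apply hW hV hev hAB n hF fW hfW hy)).trans
    (body_evalEven (hev.even y hy) _)
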